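/- Let $P_1,P_2$ be probability distributions on $[0,\infty)$, and let $X_1,X_2,\dots$ and $Y_1,Y_2,\dots$ be independent random variables such that each $X_i$ has distribution $P_1$ and each $Y_j$ has distribution $P_2$. Given $X_1,\dots,X_m$ and $Y_1,\dots,Y_n$, let $H_{X,Y}$ be the random bipartite graph with parts $V=\{v_1,\dots,v_n\}$ and $W=\{w_1,\dots,w_m\}$ in which the edges $\{w_i,v_j\}$ are inserted independently with probabilities $p_{ij}=\min\{1,X_iY_j(nm)^{-1/2}\}$. In the inhomogeneous random intersection graph $G(P_1,P_2,n,m)$ on the vertex set $V$, two distinct vertices are adjacent whenever they have a common neighbour in $H_{X,Y}$. Let $d=d(v_1)$ be the degree of $v_1$ in $G(P_1,P_2,n,m)$. Theorem 1. Let $\beta\in(0,\infty)$, and let $m,n\to\infty$ in such a way that $m/n\to\beta$. Assume that $a_1:=\mathbf{E}X_1<\infty$ and $b_1:=\mathbf{E}Y_1<\infty$. Then $d$ converges in distribution to $$d_*=\sum_{j=1}^{\Lambda_1}\tau_j,$$ where $\tau_1,\tau_2,\dots$ are independent and identically distributed and independent of $\Lambda_1$, and, for $r=0,1,2,\dots$,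 $$\mathbf{P}(\tau_1=r)=\frac{r+1}{\mathbf{E}\Lambda_2}\,\mathbf{P}(\Lambda_2=r+1),\qquad \mathbf{P}(\Lambda_i=r)=\mathbf{E}\,e^{-\lambda_i}\frac{\lambda_i^r}{r!},\quad i=1,2,$$ with $\lambda_1=Y_1a_1\beta^{1/2}$ and $\lambda_2=X_1b_1\beta^{-1/2}$. (If $\mathbf{E}\Lambda_2=0$, that is, if $X_1=0$ almost surely or $Y_1=0$ almost surely, then $\Lambda_1=0$ almost surely and $d_*=0$.) -/

import Mathlib

open MeasureTheory ProbabilityTheory Filter Topology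
open scoped NNReal ENNReal unitInterval

noncomputable section

namespace RIG

/-! ### The random graph -/

/-- The edge probability `p = min {1, x y (n m)^{-1/2}}`, as a point of `[0,1]`. -/
def edgeProb (n m : ℕ) (x y : ℝ≥0) : I :=
  ⟨min 1 ((x : ℝ) * y / Real.sqrt ((n : ℝ) * m)), by
    constructor
    · exact le_min zero_le_one (by positivity)
    · exact min_le_left _ _⟩

/-- The conditional law of the bipartite graph `H_{X,Y}` given `X = x` and `Y = y`. A bipartite
graph with parts `W = {w_i : i ∈ Fin m}` and `V = {v_j : j ∈ Fin n}` is recorded by the indicators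
`h i j` of the edges `{w_i, v_j}`; these are independent Bernoulli variables with parameters
`edgeProb n m (x i) (y j)`. -/
def bipartiteLaw (n m : ℕ) (x : Fin m → ℝ≥0) (y : Fin n → ℝ≥0) :
    Measure (Fin m → Fin n → Bool) :=
  Measure.pi fun i => Measure.pi fun j => bernoulliMeasure true false (edgeProb n m (x i) (y j))

instance (n m : ℕ) (x : Fin m → ℝ≥0) (y : Fin n → ℝ≥0) :
    IsProbabilityMeasure (bipartiteLaw n m x y) := by
  unfold bipartiteLaw; infer_instance

theorem measurable_edgeProb (n m : ℕ) :
    Measurable fun p : ℝ≥0 × ℝ≥0 => edgeProb n m p.1 p.2 := by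
  unfold edgeProb
  refine Measurable.subtype_mk ?_
  fun_prop

theorem measurable_bipartiteLaw (n m : ℕ) :
    Measurable fun p : (Fin m → ℝ≥0) × (Fin n → ℝ≥0) => bipartiteLaw n m p.1 p.2 := by
  refine Measure.measurable_of_measurable_coe _ fun s _ => ?_
  have hfun : (fun p : (Fin m → ℝ≥0) × (Fin n → ℝ≥0) => bipartiteLaw n m p.1 p.2 s) =
      fun p => ∑ h ∈ s.toFinite.toFinset, ∏ i, ∏ j,
        bernoulliMeasure true false (edgeProb n m (p.1 i) (p.2 j)) {h i j} := by
    funext p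
    have hs := MeasureTheory.sum_measure_singleton (μ := bipartiteLaw n m p.1 p.2)
      (s := s.toFinite.toFinset)
    rw [Set.Finite.coe_toFinset] at hs
    rw [← hs]
    refine Finset.sum_congr rfl fun h _ => ?_
    rw [bipartiteLaw, Measure.pi_singleton]
    refine Finset.prod_congr rfl fun i _ => ?_
    rw [Measure.pi_singleton]
  rw [hfun]
  refine Finset.measurable_sum _ fun h _ => Finset.measurable_prod _ fun i _ =>
    Finset.measurable_prod _ fun j _ => ?_
  have hp : Measurable fun p : (Fin m → ℝ≥0) × (Fin n → ℝ≥0) =>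
      edgeProb n m (p.1 i) (p.2 j) :=
    (measurable_edgeProb n m).comp (by fun_prop : Measurable
      fun p : (Fin m → ℝ≥0) × (Fin n → ℝ≥0) => (p.1 i, p.2 j))
  simp only [bernoulliMeasure_def, Measure.add_apply, Measure.smul_apply]
  have h1 : Measurable fun q : I => unitInterval.toNNReal q := by fun_prop
  have h2 : Measurable fun q : I => unitInterval.toNNReal (unitInterval.symm q) := by fun_prop
  exact ((h1.comp hp).coe_nnreal_ennreal.mul_const _).add
    ((h2.comp hp).coe_nnreal_ennreal.mul_const _)

/-- `bipartiteLaw` as a Markov kernel. -/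
def bipartiteKernel (n m : ℕ) :
    Kernel ((Fin m → ℝ≥0) × (Fin n → ℝ≥0)) (Fin m → Fin n → Bool) where
  toFun p := bipartiteLaw n m p.1 p.2
  measurable' := measurable_bipartiteLaw n m

instance (n m : ℕ) : IsMarkovKernel (bipartiteKernel n m) :=
  ⟨fun p => inferInstanceAs (IsProbabilityMeasure (bipartiteLaw n m p.1 p.2))⟩

/-- The joint law of `((X, Y), H_{X,Y})`: the weights `X_1, …, X_m` (with law `P₁`) and
`Y_1, …, Y_n` (with law `P₂`) are all independent, and, given them, the bipartite graph has the
conditional law `bipartiteLaw`. -/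
def modelLaw (P₁ P₂ : Measure ℝ≥0) [IsProbabilityMeasure P₁] [IsProbabilityMeasure P₂]
    (n m : ℕ) : Measure (((Fin m → ℝ≥0) × (Fin n → ℝ≥0)) × (Fin m → Fin n → Bool)) :=
  ((Measure.pi fun _ => P₁).prod (Measure.pi fun _ => P₂)) ⊗ₘ bipartiteKernel n m

instance (P₁ P₂ : Measure ℝ≥0) [IsProbabilityMeasure P₁] [IsProbabilityMeasure P₂] (n m : ℕ) :
    IsProbabilityMeasure (modelLaw P₁ P₂ n m) := by
  unfold modelLaw; infer_instance

/-- The intersection graph of a bipartite graph: two distinct vertices of `V` are adjacent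
whenever they have a common neighbour in `W`. -/
def intersectionGraph {n m : ℕ} (h : Fin m → Fin n → Bool) : SimpleGraph (Fin n) where
  Adj v v' := v ≠ v' ∧ ∃ i, h i v = true ∧ h i v' = true
  symm := ⟨fun _ _ ⟨hne, i, h1, h2⟩ => ⟨hne.symm, i, h2, h1⟩⟩
  loopless := ⟨fun _ hv => hv.1 rfl⟩

instance {n m : ℕ} (h : Fin m → Fin n → Bool) : DecidableRel (intersectionGraph h).Adj :=
  fun v v' => inferInstanceAs (Decidable (v ≠ v' ∧ ∃ i, h i v = true ∧ h i v' = true))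

/-! ### The limit -/

/-- The mean of a law on `[0,∞)` (used for laws with finite mean only). -/
def mean (P : Measure ℝ≥0) : ℝ≥0 := (∫⁻ x, (x : ℝ≥0∞) ∂P).toNNReal

/-- The mixed Poisson distribution with random intensity `λ = c ξ`, where `ξ` has law `P`:
the probability of `r` is `E (e^{-λ} λ^r / r!)`. -/
def mixedPoisson (P : Measure ℝ≥0) [IsProbabilityMeasure P] (c : ℝ≥0) : PMF ℕ :=
  ⟨fun r => ∫⁻ x, ENNReal.ofReal
      (Real.exp (-((x * c : ℝ≥0) : ℝ)) * ((x * c : ℝ≥0) : ℝ) ^ r / (r.factorial : ℝ)) ∂P, by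
    have hsum : ∑' r : ℕ, ∫⁻ x : ℝ≥0, ENNReal.ofReal
        (Real.exp (-((x * c : ℝ≥0) : ℝ)) * ((x * c : ℝ≥0) : ℝ) ^ r / (r.factorial : ℝ)) ∂P
        = 1 := by
      rw [← lintegral_tsum fun r => by fun_prop]
      have h1 : ∀ x : ℝ≥0, ∑' r : ℕ, ENNReal.ofReal
          (Real.exp (-((x * c : ℝ≥0) : ℝ)) * ((x * c : ℝ≥0) : ℝ) ^ r / (r.factorial : ℝ))
          = 1 := by
        intro x
        rw [← ENNReal.ofReal_tsum_of_nonneg (fun r => by positivity)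
          (hasSum_one_poissonMeasure (x * c)).summable,
          (hasSum_one_poissonMeasure (x * c)).tsum_eq, ENNReal.ofReal_one]
      simp only [h1, lintegral_const, measure_univ, mul_one]
    exact ENNReal.summable.hasSum_iff.2 hsum⟩

/-- The mean of a distribution on `{0, 1, 2, …}`. -/
def pmfMean (Q : PMF ℕ) : ℝ≥0∞ := ∑' r : ℕ, (r : ℝ≥0∞) * Q r

theorem tsum_shift (Q : PMF ℕ) : ∑' r : ℕ, ((r : ℝ≥0∞) + 1) * Q (r + 1) = pmfMean Q := by
  rw [pmfMean, tsum_eq_zero_add' (f := fun r : ℕ => (r : ℝ≥0∞) * Q r) ENNReal.summable]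
  simp

open Classical in
/-- The (shifted) size-biased distribution of `Q`: the probability of `r` is
`(r + 1) Q(r + 1) / E Q`. It makes sense when the mean of `Q` is positive and finite; otherwise
we put the unit mass at `0`. -/
def sizeBiased (Q : PMF ℕ) : PMF ℕ :=
  if hQ : pmfMean Q ≠ 0 ∧ pmfMean Q ≠ ∞ then
    ⟨fun r => ((r : ℝ≥0∞) + 1) / pmfMean Q * Q (r + 1), by
      have hsum : ∑' r : ℕ, ((r : ℝ≥0∞) + 1) / pmfMean Q * Q (r + 1) = 1 := by
        have h1 : ∀ r : ℕ, ((r : ℝ≥0∞) + 1) / pmfMean Q * Q (r + 1)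
            = (pmfMean Q)⁻¹ * (((r : ℝ≥0∞) + 1) * Q (r + 1)) := fun r => by
          rw [div_eq_mul_inv]; ring
        simp only [h1]
        rw [ENNReal.tsum_mul_left, tsum_shift, ENNReal.inv_mul_cancel hQ.1 hQ.2]
      exact ENNReal.summable.hasSum_iff.2 hsum⟩
  else PMF.pure 0

/-- The law of `Λ₁`: mixed Poisson with intensity `λ₁ = Y₁ a₁ β^{1/2}`, `a₁ = E X₁`. -/
def lawΛ₁ (P₁ P₂ : Measure ℝ≥0) [IsProbabilityMeasure P₂] (β : ℝ≥0) : PMF ℕ :=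
  mixedPoisson P₂ (mean P₁ * NNReal.sqrt β)

/-- The law of `Λ₂`: mixed Poisson with intensity `λ₂ = X₁ b₁ β^{-1/2}`, `b₁ = E Y₁`. -/
def lawΛ₂ (P₁ P₂ : Measure ℝ≥0) [IsProbabilityMeasure P₁] (β : ℝ≥0) : PMF ℕ :=
  mixedPoisson P₁ (mean P₂ * (NNReal.sqrt β)⁻¹)

/-- The joint law of `(Λ₁, (τ₁, τ₂, …))`: all these variables are independent and every `τ_j` has
the distribution `P(τ_j = r) = (r + 1) P(Λ₂ = r + 1) / E Λ₂`. -/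
def limitLaw (P₁ P₂ : Measure ℝ≥0) [IsProbabilityMeasure P₁] [IsProbabilityMeasure P₂]
    (β : ℝ≥0) : Measure (ℕ × (ℕ → ℕ)) :=
  (lawΛ₁ P₁ P₂ β).toMeasure.prod
    (Measure.infinitePi fun _ : ℕ => (sizeBiased (lawΛ₂ P₁ P₂ β)).toMeasure)

instance (P₁ P₂ : Measure ℝ≥0) [IsProbabilityMeasure P₁] [IsProbabilityMeasure P₂] (β : ℝ≥0) :
    IsProbabilityMeasure (limitLaw P₁ P₂ β) := by
  unfold limitLaw; infer_instance

/-- The compound sum `d_* = ∑_{j ≤ Λ₁} τ_j` of `ω = (Λ₁, (τ₁, τ₂, …))`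
(the sequence `τ` is indexed from `0` here). -/
def dStar (ω : ℕ × (ℕ → ℕ)) : ℕ := ∑ j ∈ Finset.range ω.1, ω.2 j

end RIG

end

/-! A law on ℕ is determined by its generating function on the unit circle, where `z = e^{it}` gives
the characteristic function at `t`; so it suffices to follow `E z^d` for `‖z‖ = 1`. Up to rare
coincidences, `d` is the number of paths `v_1 – w – v_j` (`pathCount`), a sum over the `m` rows of
the incidence matrix. Fix the weights `y` of `V` and average over those of `W`: the rows become
independent and identically distributed, and the generating function is `(1 - u)^m`, where `u = E
p(X, y_0) (1 - G(X))` and `G(x)` is the generating function of the number of other neighbours of a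
`w` of weight `x` (`offspringGen`). Here `m p(x, y_0) → √β x y_0`, and `G(x)` tends to a Poisson
generating function of mean `x b_1 / √β`, so `(1 - u)^m → exp(-√β y_0 · limitRate)`. The factor `x`
coming from `m p` is what size-biases `Λ₂`; integrating over `y_0` gives the generating function of
`d_*`.

Only first moments are available, which matters twice. The Poisson limit of `G` needs `∑ p_j² → 0`;
convergence of the averages of `y` forces `max y_j = o(n)` and hence `∑ y_j² = o(n²)`
(`tendsto_sum_sq_div_sq`). This argument is deterministic, so it runs along almost every sequence
`y` by the strong law, and dominated convergence integrates over `y`. Secondly, `d` differs from the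
path count only if some `v_j` shares two neighbours with `v_1`. Truncating the weights of `W` at `K`
(`excess`) handles this: neighbours heavier than `K` are unlikely by integrability, and pairs of
lighter ones contribute `O(K⁴ y_0² ∑ y_j² / n²)`. -/

/-! ### Continuity theorem for laws on the natural numbers -/

theorem charFun_map_natCast {α : Type*} {mα : MeasurableSpace α} (ρ : Measure α) {V : α → ℕ}
    (hV : Measurable V) (t : ℝ) :
    charFun (ρ.map fun ω => (V ω : ℝ)) t = ∫ ω, Complex.exp (t * Complex.I) ^ V ω ∂ρ := by
  have hVc : Measurable fun ω => (V ω : ℝ) :=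
    (measurable_from_top : Measurable (Nat.cast : ℕ → ℝ)).comp hV
  rw [charFun_apply_real, integral_map hVc.aemeasurable]
  · refine integral_congr_ae (Eventually.of_forall fun ω => ?_)
    simp only
    rw [← Complex.exp_nat_mul]
    congr 1
    push_cast
    ring
  · exact (by fun_prop : Continuous fun x : ℝ =>
      Complex.exp (t * x * Complex.I)).aestronglyMeasurable

/-- A continuity theorem for random variables with values in `ℕ`: convergence of the generating
functions on the unit circle implies convergence in distribution. -/
theorem tendstoInDistribution_nat_of_tendsto_integral_pow {Ω : ℕ → Type*} {Ω' : Type*}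
    {mΩ : ∀ k, MeasurableSpace (Ω k)} {mΩ' : MeasurableSpace Ω'}
    {μ : ∀ k, Measure (Ω k)} [∀ k, IsProbabilityMeasure (μ k)]
    {ν : Measure Ω'} [IsProbabilityMeasure ν] {X : ∀ k, Ω k → ℕ} {Z : Ω' → ℕ}
    (hX : ∀ k, Measurable (X k)) (hZ : Measurable Z)
    (h : ∀ z : ℂ, ‖z‖ = 1 →
      Tendsto (fun k => ∫ ω, z ^ X k ω ∂μ k) atTop (𝓝 (∫ ω, z ^ Z ω ∂ν))) :
    TendstoInDistribution X atTop Z μ ν := by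
  have hcast : Measurable (Nat.cast : ℕ → ℝ) := measurable_from_top
  have hXc : ∀ k, Measurable fun ω => (X k ω : ℝ) := fun k => hcast.comp (hX k)
  have hZc : Measurable fun ω => (Z ω : ℝ) := hcast.comp hZ
  refine ⟨fun k => (hX k).aemeasurable, hZ.aemeasurable, ?_⟩
  have key : Tendsto (β := ProbabilityMeasure ℝ)
      (fun k => ⟨(μ k).map fun ω => (X k ω : ℝ),
        Measure.isProbabilityMeasure_map (hXc k).aemeasurable⟩) atTop
      (𝓝 ⟨ν.map fun ω => (Z ω : ℝ), Measure.isProbabilityMeasure_map hZc.aemeasurable⟩) := by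
    refine ProbabilityMeasure.tendsto_iff_tendsto_charFun.2 fun t => ?_
    simp only [ProbabilityMeasure.coe_mk, charFun_map_natCast _ (hX _), charFun_map_natCast _ hZ]
    exact h _ (by rw [Complex.norm_exp_ofReal_mul_I])
  refine ProbabilityMeasure.tendsto_iff_forall_integral_tendsto.2 fun f => ?_
  -- ℕ is closed in ℝ, so by Tietze a bounded test function on ℕ extends to a bounded continuous one
  -- on ℝ; weak convergence on ℝ thus descends to ℕ.
  have hemb : IsClosedEmbedding (Nat.cast : ℕ → ℝ) := Nat.isClosedEmbedding_coe_real
  obtain ⟨g, -, hg⟩ :=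
    BoundedContinuousFunction.exists_extension_norm_eq_of_isClosedEmbedding f hemb
  have hfg : ∀ j : ℕ, g (j : ℝ) = f j := fun j => congrFun hg j
  have := ProbabilityMeasure.tendsto_iff_forall_integral_tendsto.1 key g
  simp only [ProbabilityMeasure.coe_mk] at this ⊢
  rw [integral_map hZc.aemeasurable g.continuous.aestronglyMeasurable] at this
  rw [integral_map hZ.aemeasurable f.continuous.aestronglyMeasurable]
  simp only [hfg] at this
  refine this.congr fun k => ?_
  rw [integral_map (hXc k).aemeasurable g.continuous.aestronglyMeasurable,
    integral_map (hX k).aemeasurable f.continuous.aestronglyMeasurable]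
  simp only [hfg]

/-! ### Products of complex numbers close to one -/

/-- Telescoping: the factors are exchanged one at a time, and all the others stay in the unit disc.
-/
theorem norm_prod_sub_prod_le_sum {ι : Type*} (s : Finset ι) (a b : ι → ℂ)
    (ha : ∀ i ∈ s, ‖a i‖ ≤ 1) (hb : ∀ i ∈ s, ‖b i‖ ≤ 1) :
    ‖∏ i ∈ s, a i - ∏ i ∈ s, b i‖ ≤ ∑ i ∈ s, ‖a i - b i‖ := by
  classical
  induction s using Finset.induction_on with
  | empty => simp
  | insert i s hi ih =>
    rw [Finset.prod_insert hi, Finset.prod_insert hi, Finset.sum_insert hi]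
    have ih' := ih (fun j hj => ha j (Finset.mem_insert_of_mem hj))
      (fun j hj => hb j (Finset.mem_insert_of_mem hj))
    have hbs : ‖∏ j ∈ s, b j‖ ≤ 1 := by
      rw [norm_prod]
      exact Finset.prod_le_one (fun _ _ => norm_nonneg _)
        fun j hj => hb j (Finset.mem_insert_of_mem hj)
    have hai := ha i (Finset.mem_insert_self _ _)
    calc ‖a i * ∏ j ∈ s, a j - b i * ∏ j ∈ s, b j‖
        = ‖(a i - b i) * ∏ j ∈ s, b j + a i * (∏ j ∈ s, a j - ∏ j ∈ s, b j)‖ := by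
          congr 1; ring
      _ ≤ ‖a i - b i‖ * ‖∏ j ∈ s, b j‖ + ‖a i‖ * ‖∏ j ∈ s, a j - ∏ j ∈ s, b j‖ := by
          refine (norm_add_le _ _).trans ?_
          rw [norm_mul, norm_mul]
      _ ≤ ‖a i - b i‖ * 1 + 1 * ∑ j ∈ s, ‖a j - b j‖ := by gcongr
      _ = _ := by ring

/-- Products `∏ (1 - u)` over arrays of small complex numbers converge to the exponential of the
limit of the sums. -/
theorem tendsto_prod_one_sub {s : ℕ → Finset ℕ} {u : ℕ → ℕ → ℂ} {c : ℂ}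
    (hone : ∀ k, ∀ j ∈ s k, ‖1 - u k j‖ ≤ 1)
    (hsmall : ∀ᶠ k in atTop, ∀ j ∈ s k, ‖u k j‖ ≤ 1)
    (hsq : Tendsto (fun k => ∑ j ∈ s k, ‖u k j‖ ^ 2) atTop (𝓝 0))
    (hsum : Tendsto (fun k => ∑ j ∈ s k, u k j) atTop (𝓝 c)) :
    Tendsto (fun k => ∏ j ∈ s k, (1 - u k j)) atTop (𝓝 (Complex.exp (-c))) := by
  have h1 : Tendsto (fun k => Complex.exp (-∑ j ∈ s k, u k j)) atTop (𝓝 (Complex.exp (-c))) :=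
    (Complex.continuous_exp.tendsto _).comp hsum.neg
  have h2 : Tendsto (fun k => ∏ j ∈ s k, (1 - u k j) - Complex.exp (-∑ j ∈ s k, u k j)) atTop
      (𝓝 0) := by
    refine squeeze_zero_norm' ?_ hsq
    filter_upwards [hsmall] with k hk
    rw [← Finset.sum_neg_distrib, Complex.exp_sum]
    refine (norm_prod_sub_prod_le_sum _ _ _ (hone k) fun j hj => ?_).trans
      (Finset.sum_le_sum fun j hj => ?_)
    -- `‖1 - u‖ ≤ 1` forces `Re u ≥ 0`, hence `‖exp (-u)‖ ≤ 1`.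
    · rw [Complex.norm_exp]
      have := (Complex.re_le_norm _).trans (hone k j hj)
      simpa using this
    · have := Complex.norm_exp_sub_one_sub_id_le (x := -u k j) (by simpa using hk j hj)
      rw [norm_neg] at this
      refine le_trans (le_of_eq ?_) this
      rw [← norm_neg]
      congr 1
      ring
  simpa using h2.add h1

/-- A power version of `tendsto_prod_one_sub`. -/
theorem tendsto_one_sub_pow {m : ℕ → ℕ} (hm : Tendsto m atTop atTop) {u : ℕ → ℂ} {c : ℂ}
    (hone : ∀ k, ‖1 - u k‖ ≤ 1)
    (hsum : Tendsto (fun k => (m k : ℂ) * u k) atTop (𝓝 c)) :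
    Tendsto (fun k => (1 - u k) ^ m k) atTop (𝓝 (Complex.exp (-c))) := by
  have hm' : Tendsto (fun k => ((m k : ℝ))⁻¹) atTop (𝓝 0) :=
    (tendsto_natCast_atTop_atTop.comp hm).inv_tendsto_atTop
  -- `m ‖u‖² = ‖m u‖² / m`, a bounded quantity over one tending to infinity.
  have hsq : Tendsto (fun k => (m k : ℝ) * ‖u k‖ ^ 2) atTop (𝓝 0) := by
    have := (hsum.norm.pow 2).mul hm'
    rw [mul_zero] at this
    refine this.congr fun k => ?_
    rcases eq_or_ne (m k) 0 with h | h
    · simp [h]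
    · have : (m k : ℝ) ≠ 0 := by exact_mod_cast h
      simp only [norm_mul, Complex.norm_natCast]
      field_simp
  have := tendsto_prod_one_sub (s := fun k => Finset.range (m k)) (u := fun k _ => u k) (c := c)
    (fun k _ _ => hone k) ?_ (by simpa using hsq) (by simpa using hsum)
  · simpa using this
  · filter_upwards [hsq.eventually (ge_mem_nhds zero_lt_one), hm.eventually_ge_atTop 1] with k hk hk1
      j _
    have : (1 : ℝ) ≤ m k := by exact_mod_cast hk1
    by_contra! hcon
    nlinarith [norm_nonneg (u k), mul_pos (sub_pos.2 hcon) (sub_pos.2 hcon)]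

/-! ### Deterministic consequences of the convergence of averages -/

section Averages

variable {a : ℕ → ℝ} {b : ℝ}

/-- With `A n` the `n`-th average, `a n / n = A (n + 1) (1 + 1/n) - A n`. -/
theorem tendsto_div_of_tendsto_average
    (hb : Tendsto (fun n : ℕ => (∑ i ∈ Finset.range n, a i) / n) atTop (𝓝 b)) :
    Tendsto (fun n : ℕ => a n / n) atTop (𝓝 0) := by
  have h1 : Tendsto (fun n : ℕ => (∑ i ∈ Finset.range (n + 1), a i) / ((n + 1 : ℕ) : ℝ)) atTop
      (𝓝 b) := hb.comp (tendsto_add_atTop_nat 1)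
  have h2 : Tendsto (fun n : ℕ => (1 : ℝ) + 1 / (n : ℝ)) atTop (𝓝 (1 + 0)) :=
    tendsto_const_nhds.add tendsto_one_div_atTop_nhds_zero_nat
  have h3 := (h1.mul h2).sub hb
  rw [add_zero, mul_one, sub_self] at h3
  refine h3.congr' ?_
  filter_upwards [eventually_ge_atTop 1] with n hn
  have hn' : (n : ℝ) ≠ 0 := by positivity
  rw [Finset.sum_range_succ]
  push_cast
  field_simp
  ring

/-- The maximum of the first `n` terms is `o(n)`: beyond a fixed `N` one has `a j ≤ ε j ≤ ε n`, and
the finitely many earlier terms are constants. -/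
theorem eventually_forall_lt_le_mul
    (hb : Tendsto (fun n : ℕ => (∑ i ∈ Finset.range n, a i) / n) atTop (𝓝 b))
    {ε : ℝ} (hε : 0 < ε) : ∀ᶠ n : ℕ in atTop, ∀ j < n, a j ≤ ε * n := by
  obtain ⟨N, hN⟩ := eventually_atTop.1
    (((tendsto_div_of_tendsto_average hb).eventually (ge_mem_nhds hε)).and
      (eventually_ge_atTop 1))
  have hlarge : ∀ᶠ n : ℕ in atTop, ∀ j ∈ Finset.range N, a j ≤ ε * n := by
    refine (Finset.eventually_all _).2 fun j _ => ?_
    exact (tendsto_natCast_atTop_atTop.const_mul_atTop hε).eventually_ge_atTop (a j)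
  filter_upwards [hlarge] with n hn j hj
  rcases lt_or_ge j N with h | h
  · exact hn j (Finset.mem_range.2 h)
  · obtain ⟨h1, h2⟩ := hN j h
    have h2' : (0 : ℝ) < j := by exact_mod_cast h2
    have hjn : (j : ℝ) ≤ n := by exact_mod_cast hj.le
    rw [div_le_iff₀ h2'] at h1
    nlinarith

/-- The sum of squares is at most the maximum, `o(n)`, times the sum, `O(n)`. This replaces a second
moment. -/
theorem tendsto_sum_sq_div_sq (ha : ∀ i, 0 ≤ a i)
    (hb : Tendsto (fun n : ℕ => (∑ i ∈ Finset.range n, a i) / n) atTop (𝓝 b)) :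
    Tendsto (fun n : ℕ => (∑ i ∈ Finset.range n, a i ^ 2) / (n : ℝ) ^ 2) atTop (𝓝 0) := by
  have hb0 : 0 ≤ b := ge_of_tendsto' hb fun n =>
    div_nonneg (Finset.sum_nonneg fun i _ => ha i) (Nat.cast_nonneg n)
  rw [Metric.tendsto_nhds]
  intro ε hε
  -- The sum is eventually at most `(b + 1) n`, so this choice leaves `ε / 2`.
  have hδ : 0 < ε / (2 * (b + 1)) := by positivity
  filter_upwards [eventually_forall_lt_le_mul hb hδ,
    hb.eventually (ge_mem_nhds (lt_add_one b)), eventually_ge_atTop 1] with n h1 h2 h3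
  have hn : (0 : ℝ) < n := by exact_mod_cast h3
  have hnn : 0 ≤ (∑ i ∈ Finset.range n, a i ^ 2) / (n : ℝ) ^ 2 :=
    div_nonneg (Finset.sum_nonneg fun i _ => sq_nonneg _) (sq_nonneg _)
  rw [Real.dist_eq, sub_zero, abs_of_nonneg hnn, div_lt_iff₀ (by positivity)]
  rw [div_le_iff₀ hn] at h2
  calc ∑ i ∈ Finset.range n, a i ^ 2
      ≤ ∑ i ∈ Finset.range n, ε / (2 * (b + 1)) * n * a i := by
        refine Finset.sum_le_sum fun i hi => ?_
        rw [sq]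
        exact mul_le_mul_of_nonneg_right (h1 i (Finset.mem_range.1 hi)) (ha i)
    _ = ε / (2 * (b + 1)) * n * ∑ i ∈ Finset.range n, a i := by rw [Finset.mul_sum]
    _ ≤ ε / (2 * (b + 1)) * n * ((b + 1) * n) := by gcongr
    _ = ε / 2 * (n : ℝ) ^ 2 := by field_simp
    _ < ε * (n : ℝ) ^ 2 := by nlinarith [pow_pos hn 2]

end Averages

/-! ### Asymptotics of the edge probabilities and the Poisson limit of one row -/

namespace RIG

theorem edgeProb_le_div (n m : ℕ) (x y : ℝ≥0) :
    (edgeProb n m x y : ℝ) ≤ x * y / Real.sqrt (n * m) := min_le_right _ _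

theorem edgeProb_eq_div {n m : ℕ} {x y : ℝ≥0} (h : (x : ℝ) * y / Real.sqrt (n * m) ≤ 1) :
    (edgeProb n m x y : ℝ) = x * y / Real.sqrt (n * m) := min_eq_right h

section Scaling

variable {β : ℝ} {n m : ℕ → ℕ}

theorem tendsto_sqrt_mul_div (hpos : ∀ k, 0 < n k)
    (hnm : Tendsto (fun k => (m k : ℝ) / (n k : ℝ)) atTop (𝓝 β)) :
    Tendsto (fun k => Real.sqrt (n k * m k) / n k) atTop (𝓝 (Real.sqrt β)) := by
  refine ((Real.continuous_sqrt.tendsto β).comp hnm).congr fun k => ?_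
  have hn : (0 : ℝ) < n k := by exact_mod_cast hpos k
  simp only [Function.comp_apply]
  have h : ((m k : ℝ) / n k) = (n k * m k) / (n k : ℝ) ^ 2 := by field_simp
  rw [h, Real.sqrt_div' _ (by positivity), Real.sqrt_sq hn.le]

theorem tendsto_div_sqrt_mul (hβ : 0 < β) (hpos : ∀ k, 0 < n k)
    (hnm : Tendsto (fun k => (m k : ℝ) / (n k : ℝ)) atTop (𝓝 β)) :
    Tendsto (fun k => (m k : ℝ) / Real.sqrt (n k * m k)) atTop (𝓝 (Real.sqrt β)) := by
  have h := hnm.div (tendsto_sqrt_mul_div hpos hnm) (Real.sqrt_pos.2 hβ).ne'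
  rw [Real.div_sqrt] at h
  refine h.congr fun k => ?_
  have hn : (n k : ℝ) ≠ 0 := by exact_mod_cast (hpos k).ne'
  simp only [Pi.div_apply]
  field_simp

/-- Since `√(nm)` is of order `n` and `max y_j = o(n)`, the ratios vanish uniformly in `j`. With `δ
= 1` this shows that the truncation `min 1` is eventually inactive for a fixed `x`. -/
theorem eventually_forall_lt_div_le (hβ : 0 < β) (hpos : ∀ k, 0 < n k)
    (hn : Tendsto n atTop atTop)
    (hnm : Tendsto (fun k => (m k : ℝ) / (n k : ℝ)) atTop (𝓝 β)) {y : ℕ → ℝ≥0} {b : ℝ}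
    (hb : Tendsto (fun N : ℕ => (∑ i ∈ Finset.range N, (y i : ℝ)) / N) atTop (𝓝 b))
    (x : ℝ≥0) {δ : ℝ} (hδ : 0 < δ) :
    ∀ᶠ k in atTop, ∀ j < n k, (x : ℝ) * y j / Real.sqrt (n k * m k) ≤ δ := by
  have hs := Real.sqrt_pos.2 hβ
  -- `√β / 2` is an eventual lower bound for `√(nm) / n`; `x + 1` avoids a division by zero when `x
  -- = 0`.
  have hε : 0 < δ * (Real.sqrt β / 2) / (x + 1) := by positivity
  filter_upwards [hn.eventually (eventually_forall_lt_le_mul hb hε),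
    (tendsto_sqrt_mul_div hpos hnm).eventually (le_mem_nhds (half_lt_self hs))] with k h1 h2 j hj
  have hnk : (0 : ℝ) < n k := by exact_mod_cast hpos k
  rw [le_div_iff₀ hnk] at h2
  have h3 := h1 j hj
  have hspos : 0 < Real.sqrt (n k * m k) := lt_of_lt_of_le (by positivity) h2
  rw [div_le_iff₀ hspos]
  have hx1 : (0 : ℝ) < x + 1 := by positivity
  calc (x : ℝ) * y j ≤ (x + 1) * (δ * (Real.sqrt β / 2) / (x + 1) * n k) := by
        gcongr
        linarith
    _ = δ * (Real.sqrt β / 2 * n k) := by field_simp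
    _ ≤ _ := by gcongr

theorem tendsto_mul_edgeProb (hβ : 0 < β) (hpos : ∀ k, 0 < n k)
    (hn : Tendsto n atTop atTop)
    (hnm : Tendsto (fun k => (m k : ℝ) / (n k : ℝ)) atTop (𝓝 β)) {y : ℕ → ℝ≥0} {b : ℝ}
    (hb : Tendsto (fun N : ℕ => (∑ i ∈ Finset.range N, (y i : ℝ)) / N) atTop (𝓝 b)) (x : ℝ≥0) :
    Tendsto (fun k => (m k : ℝ) * edgeProb (n k) (m k) x (y 0)) atTop
      (𝓝 (Real.sqrt β * (x * y 0))) := by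
  refine ((tendsto_div_sqrt_mul hβ hpos hnm).mul_const ((x : ℝ) * y 0)).congr' ?_
  filter_upwards [eventually_forall_lt_div_le hβ hpos hn hnm hb x zero_lt_one] with k hk
  rw [edgeProb_eq_div (hk 0 (hpos k))]
  ring

/-- Once `min 1` is inactive the sum is linear in `y`; removing the index `0` costs only `y 0 / n`
in the average. -/
theorem tendsto_sum_edgeProb (hβ : 0 < β) (hpos : ∀ k, 0 < n k)
    (hn : Tendsto n atTop atTop)
    (hnm : Tendsto (fun k => (m k : ℝ) / (n k : ℝ)) atTop (𝓝 β)) {y : ℕ → ℝ≥0} {b : ℝ}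
    (hb : Tendsto (fun N : ℕ => (∑ i ∈ Finset.range N, (y i : ℝ)) / N) atTop (𝓝 b)) (x : ℝ≥0) :
    Tendsto (fun k => ∑ j ∈ (Finset.range (n k)).erase 0,
      (edgeProb (n k) (m k) x (y j) : ℝ)) atTop (𝓝 (x * (b / Real.sqrt β))) := by
  have hs := Real.sqrt_pos.2 hβ
  have hnR : Tendsto (fun k => ((n k : ℝ))⁻¹) atTop (𝓝 0) :=
    (tendsto_natCast_atTop_atTop.comp hn).inv_tendsto_atTop
  have h1 := (((hb.comp hn).sub (hnR.const_mul (y 0 : ℝ))).div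
    (tendsto_sqrt_mul_div hpos hnm) hs.ne').const_mul (x : ℝ)
  rw [mul_zero, sub_zero] at h1
  refine h1.congr' ?_
  filter_upwards [eventually_forall_lt_div_le hβ hpos hn hnm hb x zero_lt_one] with k hk
  have hnk : (n k : ℝ) ≠ 0 := by exact_mod_cast (hpos k).ne'
  have h2 : ∑ j ∈ (Finset.range (n k)).erase 0, (edgeProb (n k) (m k) x (y j) : ℝ)
      = ∑ j ∈ (Finset.range (n k)).erase 0, (x : ℝ) * y j / Real.sqrt (n k * m k) :=
    Finset.sum_congr rfl fun j hj =>
      edgeProb_eq_div (hk j (Finset.mem_range.1 (Finset.mem_of_mem_erase hj)))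
  rw [h2, ← Finset.sum_div, ← Finset.mul_sum,
    Finset.sum_erase_eq_sub (Finset.mem_range.2 (hpos k))]
  simp only [Function.comp_apply, Pi.div_apply]
  field_simp

theorem eventually_forall_lt_edgeProb_le (hβ : 0 < β) (hpos : ∀ k, 0 < n k)
    (hn : Tendsto n atTop atTop)
    (hnm : Tendsto (fun k => (m k : ℝ) / (n k : ℝ)) atTop (𝓝 β)) {y : ℕ → ℝ≥0} {b : ℝ}
    (hb : Tendsto (fun N : ℕ => (∑ i ∈ Finset.range N, (y i : ℝ)) / N) atTop (𝓝 b))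
    (x : ℝ≥0) {δ : ℝ} (hδ : 0 < δ) :
    ∀ᶠ k in atTop, ∀ j < n k, (edgeProb (n k) (m k) x (y j) : ℝ) ≤ δ := by
  filter_upwards [eventually_forall_lt_div_le hβ hpos hn hnm hb x hδ] with k hk j hj
  exact (edgeProb_le_div _ _ _ _).trans (hk j hj)

theorem tendsto_sum_edgeProb_sq (hβ : 0 < β) (hpos : ∀ k, 0 < n k)
    (hn : Tendsto n atTop atTop)
    (hnm : Tendsto (fun k => (m k : ℝ) / (n k : ℝ)) atTop (𝓝 β)) {y : ℕ → ℝ≥0} {b : ℝ}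
    (hb : Tendsto (fun N : ℕ => (∑ i ∈ Finset.range N, (y i : ℝ)) / N) atTop (𝓝 b)) (x : ℝ≥0) :
    Tendsto (fun k => ∑ j ∈ (Finset.range (n k)).erase 0,
      (edgeProb (n k) (m k) x (y j) : ℝ) ^ 2) atTop (𝓝 0) := by
  have hs := Real.sqrt_pos.2 hβ
  have h1 := (((tendsto_sum_sq_div_sq (fun i => (y i).coe_nonneg) hb).comp hn).div
    ((tendsto_sqrt_mul_div hpos hnm).pow 2) (by positivity)).const_mul ((x : ℝ) ^ 2)
  rw [zero_div, mul_zero] at h1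
  refine squeeze_zero (fun k => Finset.sum_nonneg fun j _ => sq_nonneg _) (fun k => ?_) h1
  have hnk : (n k : ℝ) ≠ 0 := by exact_mod_cast (hpos k).ne'
  calc ∑ j ∈ (Finset.range (n k)).erase 0, (edgeProb (n k) (m k) x (y j) : ℝ) ^ 2
      ≤ ∑ j ∈ Finset.range (n k), (edgeProb (n k) (m k) x (y j) : ℝ) ^ 2 :=
        Finset.sum_le_sum_of_subset_of_nonneg (Finset.erase_subset _ _)
          fun j _ _ => sq_nonneg _
    _ ≤ ∑ j ∈ Finset.range (n k), ((x : ℝ) * y j / Real.sqrt (n k * m k)) ^ 2 := by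
        refine Finset.sum_le_sum fun j _ => ?_
        exact pow_le_pow_left₀ (edgeProb (n k) (m k) x (y j)).2.1 (edgeProb_le_div _ _ _ _) 2
    _ = _ := by
        simp only [div_pow, mul_pow, ← Finset.sum_div, ← Finset.mul_sum, Function.comp_apply,
          Pi.div_apply]
        field_simp

/-- The probability generating function of the number of neighbours of a vertex `w` of weight
`x` other than `v_0`. -/
noncomputable def offspringGen (n m : ℕ) (y : ℕ → ℝ≥0) (z : ℂ) (x : ℝ≥0) : ℂ :=
  ∏ j ∈ (Finset.range n).erase 0, (1 - (edgeProb n m x (y j) : ℝ) * (1 - z))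

/-- The number is the convex combination `(1 - p) · 1 + p · z` of points of the unit disc. -/
theorem norm_one_sub_mul_le {z : ℂ} (hz : ‖z‖ ≤ 1) (p : I) : ‖1 - (p : ℝ) * (1 - z)‖ ≤ 1 := by
  have h : (1 : ℂ) - (p : ℝ) * (1 - z) = ((1 - p : ℝ) : ℂ) + (p : ℝ) * z := by
    push_cast; ring
  rw [h]
  refine (norm_add_le _ _).trans ?_
  rw [norm_mul, Complex.norm_real, Complex.norm_real, Real.norm_of_nonneg p.2.1,
    Real.norm_of_nonneg (sub_nonneg.2 p.2.2)]
  nlinarith [p.2.1]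

theorem norm_offspringGen_le {z : ℂ} (hz : ‖z‖ ≤ 1) (n m : ℕ) (y : ℕ → ℝ≥0) (x : ℝ≥0) :
    ‖offspringGen n m y z x‖ ≤ 1 := by
  rw [offspringGen, norm_prod]
  exact Finset.prod_le_one (fun _ _ => norm_nonneg _) fun j _ => norm_one_sub_mul_le hz _

theorem tendsto_offspringGen (hβ : 0 < β) (hpos : ∀ k, 0 < n k)
    (hn : Tendsto n atTop atTop)
    (hnm : Tendsto (fun k => (m k : ℝ) / (n k : ℝ)) atTop (𝓝 β)) {y : ℕ → ℝ≥0} {b : ℝ}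
    (hb : Tendsto (fun N : ℕ => (∑ i ∈ Finset.range N, (y i : ℝ)) / N) atTop (𝓝 b))
    {z : ℂ} (hz : ‖z‖ ≤ 1) (x : ℝ≥0) :
    Tendsto (fun k => offspringGen (n k) (m k) y z x) atTop
      (𝓝 (Complex.exp (-((x * (b / Real.sqrt β) : ℝ) * (1 - z))))) := by
  have hw : ‖1 - z‖ ≤ 2 := (norm_sub_le _ _).trans (by rw [norm_one]; linarith)
  have hnorm : ∀ k j, ‖((edgeProb (n k) (m k) x (y j) : ℝ) : ℂ) * (1 - z)‖
      = edgeProb (n k) (m k) x (y j) * ‖1 - z‖ := fun k j => by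
    rw [norm_mul, Complex.norm_real, Real.norm_of_nonneg (edgeProb _ _ _ _).2.1]
  refine tendsto_prod_one_sub (fun k j _ => norm_one_sub_mul_le hz _) ?_ ?_ ?_
  · filter_upwards [eventually_forall_lt_edgeProb_le hβ hpos hn hnm hb x one_half_pos] with k hk j hj
    rw [hnorm]
    have := hk j (Finset.mem_range.1 (Finset.mem_of_mem_erase hj))
    have h0 := (edgeProb (n k) (m k) x (y j)).2.1
    nlinarith [norm_nonneg (1 - z)]
  · have := (tendsto_sum_edgeProb_sq hβ hpos hn hnm hb x).mul_const (‖1 - z‖ ^ 2)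
    rw [zero_mul] at this
    refine this.congr fun k => ?_
    rw [Finset.sum_mul]
    exact Finset.sum_congr rfl fun j _ => by rw [hnorm, mul_pow]
  · have := ((Complex.continuous_ofReal.tendsto _).comp
      (tendsto_sum_edgeProb hβ hpos hn hnm hb x)).mul_const (1 - z)
    refine this.congr fun k => ?_
    simp only [Function.comp_apply, Complex.ofReal_sum, Finset.sum_mul]

end Scaling

end RIG

/-! ### Generating function of the path count for given weights -/

theorem integral_bernoulliMeasure_bool {E : Type*} [NormedAddCommGroup E] [NormedSpace ℝ E]
    [CompleteSpace E] (p : I) (f : Bool → E) :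
    ∫ b, f b ∂bernoulliMeasure true false p = (p : ℝ) • f true + (1 - p : ℝ) • f false := by
  rw [bernoulliMeasure_def, integral_add_measure .of_finite .of_finite,
    integral_smul_nnreal_measure, integral_smul_nnreal_measure, integral_dirac, integral_dirac]
  rfl

theorem integral_pi_mul_of_ne {ι : Type*} [Fintype ι] {E : ι → Type*}
    {mE : ∀ i, MeasurableSpace (E i)} (μ : ∀ i, Measure (E i)) [∀ i, IsProbabilityMeasure (μ i)]
    {i i' : ι} (hii : i ≠ i') {f : E i → ℝ} {g : E i' → ℝ} (hf : Measurable f)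
    (hg : Measurable g) :
    ∫ x, f (x i) * g (x i') ∂Measure.pi μ = (∫ x, f x ∂μ i) * ∫ x, g x ∂μ i' := by
  have h1 : iIndepFun (fun i (x : ∀ i, E i) => x i) (Measure.pi μ) :=
    iIndepFun_pi (X := fun i => (id : E i → E i)) fun i => aemeasurable_id
  have h2 := ((h1.indepFun hii).comp hf hg).integral_fun_mul_eq_mul_integral
    (hf.comp (measurable_pi_apply i)).aestronglyMeasurable
    (hg.comp (measurable_pi_apply i')).aestronglyMeasurable
  simp only [Function.comp_apply] at h2
  rw [h2, integral_comp_eval hf.aestronglyMeasurable, integral_comp_eval hg.aestronglyMeasurable]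

theorem Finset.prod_fin_erase_eq_prod_range_erase {M : Type*} [CommMonoid M] {n : ℕ} (hn : 0 < n)
    (f : ℕ → M) :
    ∏ j ∈ (Finset.univ : Finset (Fin n)).erase ⟨0, hn⟩, f j
      = ∏ j ∈ (Finset.range n).erase 0, f j := by
  refine Finset.prod_nbij (fun j : Fin n => (j : ℕ)) ?_ (Fin.val_injective.injOn) ?_
    fun _ _ => rfl
  · intro j hj
    have h := Finset.ne_of_mem_erase hj
    exact Finset.mem_erase.2 ⟨fun h0 => h (Fin.ext h0), Finset.mem_range.2 j.2⟩
  · intro j hj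
    have hj' := Finset.mem_erase.1 (Finset.mem_coe.1 hj)
    refine ⟨⟨j, Finset.mem_range.1 hj'.2⟩, Finset.mem_coe.2 (Finset.mem_erase.2
      ⟨fun h => hj'.1 (congrArg Fin.val h), Finset.mem_univ _⟩), rfl⟩

namespace RIG

variable {n m : ℕ}

/-- The number of `1`s other than the one at `v` in a row of the incidence matrix, if the row
has a `1` at `v`. -/
def rowCount (v : Fin n) (r : Fin n → Bool) : ℕ :=
  if r v then ∑ j ∈ Finset.univ.erase v, (r j).toNat else 0

/-- The number of paths of length two from `v` to other vertices of `V` in the bipartite graph;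
it is the degree of `v` counted with multiplicity. -/
def pathCount (v : Fin n) (h : Fin m → Fin n → Bool) : ℕ := ∑ i, rowCount v (h i)

theorem integral_pow_rowCount (p : Fin n → I) (v : Fin n) (z : ℂ) :
    ∫ r, z ^ rowCount v r ∂Measure.pi (fun j => bernoulliMeasure true false (p j))
      = 1 - (p v : ℝ) * (1 - ∏ j ∈ Finset.univ.erase v, (1 - (p j : ℝ) * (1 - z))) := by
  -- `f` carries the event that the edge at `v` is absent, where the count is `0`, and `g` the event
  -- that it is present. Each is a product over coordinates, so its integral factorises.
  let f : Fin n → Bool → ℂ := fun j b => if j = v then (if b then 0 else 1) else 1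
  let g : Fin n → Bool → ℂ := fun j b => if j = v then (if b then 1 else 0) else z ^ b.toNat
  have hsplit : ∀ r : Fin n → Bool, z ^ rowCount v r = ∏ j, f j (r j) + ∏ j, g j (r j) := by
    intro r
    rw [← Finset.mul_prod_erase _ (fun j => f j (r j)) (Finset.mem_univ v),
      ← Finset.mul_prod_erase _ (fun j => g j (r j)) (Finset.mem_univ v)]
    have h1 : ∏ j ∈ Finset.univ.erase v, f j (r j) = 1 :=
      Finset.prod_eq_one fun j hj => by simp [f, Finset.ne_of_mem_erase hj]
    have h2 : ∏ j ∈ Finset.univ.erase v, g j (r j)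
        = z ^ ∑ j ∈ Finset.univ.erase v, (r j).toNat := by
      rw [← Finset.prod_pow_eq_pow_sum]
      exact Finset.prod_congr rfl fun j hj => by simp [g, Finset.ne_of_mem_erase hj]
    rw [h1, h2]
    cases hv : r v <;> simp [rowCount, f, g, hv]
  simp only [hsplit]
  rw [integral_add .of_finite .of_finite, integral_fintype_prod_eq_prod,
    integral_fintype_prod_eq_prod]
  simp only [integral_bernoulliMeasure_bool]
  rw [← Finset.mul_prod_erase _ _ (Finset.mem_univ v),
    ← Finset.mul_prod_erase _ _ (Finset.mem_univ v)]
  have h1 : ∏ j ∈ Finset.univ.erase v,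
      ((p j : ℝ) • f j true + (1 - p j : ℝ) • f j false) = 1 := by
    refine Finset.prod_eq_one fun j hj => ?_
    simp [f, Finset.ne_of_mem_erase hj]
  have h2 : ∏ j ∈ Finset.univ.erase v,
      ((p j : ℝ) • g j true + (1 - p j : ℝ) • g j false)
      = ∏ j ∈ Finset.univ.erase v, (1 - (p j : ℝ) * (1 - z)) := by
    refine Finset.prod_congr rfl fun j hj => ?_
    simp [g, Finset.ne_of_mem_erase hj]
    ring
  rw [h1, h2]
  simp [f, g]
  ring

theorem integral_pow_pathCount (x : Fin m → ℝ≥0) (y : Fin n → ℝ≥0) (v : Fin n) (z : ℂ) :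
    ∫ h, z ^ pathCount v h ∂bipartiteLaw n m x y
      = ∏ i, (1 - (edgeProb n m (x i) (y v) : ℝ) *
        (1 - ∏ j ∈ Finset.univ.erase v, (1 - (edgeProb n m (x i) (y j) : ℝ) * (1 - z)))) := by
  simp only [pathCount, ← Finset.prod_pow_eq_pow_sum, bipartiteLaw]
  rw [integral_fintype_prod_eq_prod (fun _ r => z ^ rowCount v r)]
  exact Finset.prod_congr rfl fun i _ => integral_pow_rowCount _ v z

theorem measurable_edgeProb_left (y : ℝ≥0) :
    Measurable fun x => (edgeProb n m x y : ℝ) :=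
  measurable_subtype_coe.comp ((measurable_edgeProb n m).comp (measurable_id.prodMk measurable_const))

theorem measurable_offspringGen (y : ℕ → ℝ≥0) (z : ℂ) : Measurable (offspringGen n m y z) := by
  unfold offspringGen
  refine Finset.measurable_prod _ fun j _ => ?_
  have := Complex.measurable_ofReal.comp (measurable_edgeProb_left (n := n) (m := m) (y j))
  exact (this.mul_const _).const_sub 1

variable (P : Measure ℝ≥0) [IsProbabilityMeasure P]

theorem norm_edgeProb_mul_one_sub_offspringGen_le {z : ℂ} (hz : ‖z‖ ≤ 1) (y : ℕ → ℝ≥0)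
    (x : ℝ≥0) :
    ‖(edgeProb n m x (y 0) : ℝ) * (1 - offspringGen n m y z x)‖
      ≤ 2 * edgeProb n m x (y 0) := by
  rw [norm_mul, Complex.norm_real, Real.norm_of_nonneg (edgeProb _ _ _ _).2.1, mul_comm]
  refine mul_le_mul_of_nonneg_right ((norm_sub_le _ _).trans ?_) (edgeProb _ _ _ _).2.1
  rw [norm_one]
  linarith [norm_offspringGen_le hz n m y x]

theorem integrable_edgeProb_mul_one_sub_offspringGen {z : ℂ} (hz : ‖z‖ ≤ 1) (y : ℕ → ℝ≥0) :
    Integrable (fun x => (edgeProb n m x (y 0) : ℝ) * (1 - offspringGen n m y z x)) P := by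
  refine Integrable.of_bound (C := 2) ?_ (Eventually.of_forall fun x => ?_)
  · exact ((Complex.measurable_ofReal.comp (measurable_edgeProb_left (y 0))).mul
      ((measurable_offspringGen y z).const_sub 1)).aestronglyMeasurable
  · refine (norm_edgeProb_mul_one_sub_offspringGen_le hz y x).trans ?_
    linarith [(edgeProb n m x (y 0)).2.2]

/-- For fixed `y` the product over rows has its `i`-th factor depending on `x i` alone, so
integrating over independent, identically distributed weights turns it into an `m`-th power. -/
theorem integral_integral_pow_pathCount (hn : 0 < n) (y : ℕ → ℝ≥0) {z : ℂ} (hz : ‖z‖ ≤ 1) :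
    ∫ x, ∫ h, z ^ pathCount ⟨0, hn⟩ h ∂bipartiteLaw n m x (fun j => y j)
        ∂Measure.pi (fun _ : Fin m => P)
      = (1 - ∫ x, (edgeProb n m x (y 0) : ℝ) * (1 - offspringGen n m y z x) ∂P) ^ m := by
  have h1 : ∀ x : Fin m → ℝ≥0,
      ∫ h, z ^ pathCount ⟨0, hn⟩ h ∂bipartiteLaw n m x (fun j => y j)
        = ∏ i, (1 - (edgeProb n m (x i) (y 0) : ℝ) * (1 - offspringGen n m y z (x i))) := by
    intro x
    rw [integral_pow_pathCount]
    refine Finset.prod_congr rfl fun i _ => ?_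
    rw [offspringGen, ← Finset.prod_fin_erase_eq_prod_range_erase hn]
  simp only [h1]
  rw [integral_fintype_prod_eq_pow (fun x =>
    1 - (edgeProb n m x (y 0) : ℝ) * (1 - offspringGen n m y z x)), Fintype.card_fin,
    integral_sub (integrable_const _) (integrable_edgeProb_mul_one_sub_offspringGen P hz y)]
  simp

end RIG

/-! ### Comparison of the degree with the path count -/

namespace RIG

variable {n m : ℕ}

/-- The indicator of an edge, as a real number. -/
def ind (b : Bool) : ℝ := if b then 1 else 0

theorem ind_nonneg (b : Bool) : 0 ≤ ind b := by cases b <;> simp [ind]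

theorem integral_ind (p : I) : ∫ b, ind b ∂bernoulliMeasure true false p = p := by
  rw [integral_bernoulliMeasure_bool]
  simp [ind]

/-- Exchanging sums, the path count adds up the numbers of common neighbours of `v` and `j`, while
the degree adds up the indicators that these are positive; they agree unless some number is at least
two. -/
theorem exists_ne_of_degree_ne_pathCount (v : Fin n) (h : Fin m → Fin n → Bool)
    (hne : (intersectionGraph h).degree v ≠ pathCount v h) :
    ∃ j ≠ v, ∃ i i', i ≠ i' ∧ (h i v = true ∧ h i j = true) ∧ h i' v = true ∧ h i' j = true := by
  by_contra! hcon
  apply hne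
  have h1 : pathCount v h
      = ∑ j ∈ Finset.univ.erase v, (Finset.univ.filter fun i => h i v ∧ h i j).card := by
    have : ∀ i, rowCount v (h i)
        = ∑ j ∈ Finset.univ.erase v, if h i v ∧ h i j then 1 else 0 := by
      intro i
      unfold rowCount
      cases hv : h i v
      · simp
      · simp only [if_true, true_and]
        refine Finset.sum_congr rfl fun j _ => ?_
        cases h i j <;> rfl
    simp only [pathCount, this]
    rw [Finset.sum_comm]
    simp
  have h2 : (intersectionGraph h).degree v
      = ∑ j ∈ Finset.univ.erase v, if ∃ i, h i v ∧ h i j then 1 else 0 := by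
    rw [← SimpleGraph.card_neighborFinset_eq_degree, Finset.sum_boole, Nat.cast_id]
    congr 1
    ext j
    rw [SimpleGraph.mem_neighborFinset, Finset.mem_filter, Finset.mem_erase]
    change v ≠ j ∧ _ ↔ _
    rw [ne_comm]
    simp only [Finset.mem_univ, and_true]
  rw [h1, h2]
  refine Finset.sum_congr rfl fun j hj => ?_
  have hjv := Finset.ne_of_mem_erase hj
  have hle : (Finset.univ.filter fun i => h i v ∧ h i j).card ≤ 1 := by
    refine Finset.card_le_one.2 fun i hi i' hi' => ?_
    by_contra hii
    simp only [Finset.mem_filter, Finset.mem_univ, true_and] at hi hi'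
    exact hcon j hjv i i' hii hi hi'.1 hi'.2
  split_ifs with hex
  · obtain ⟨i, hi⟩ := hex
    refine le_antisymm ?_ hle
    exact Finset.card_pos.2 ⟨i, by simpa using hi⟩
  · push Not at hex
    symm
    rw [Finset.card_eq_zero, Finset.filter_eq_empty_iff]
    intro i _ hi
    exact hex i hi.1 hi.2

/-- The indicator of the weights larger than `K`. -/
noncomputable def big (K x : ℝ≥0) : ℝ := if K < x then 1 else 0

/-- The indicator of the weights not larger than `K`. -/
noncomputable def small (K x : ℝ≥0) : ℝ := if K < x then 0 else 1

theorem measurable_big (K : ℝ≥0) : Measurable (big K) :=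
  Measurable.ite measurableSet_Ioi measurable_const measurable_const

theorem measurable_small (K : ℝ≥0) : Measurable (small K) :=
  Measurable.ite measurableSet_Ioi measurable_const measurable_const

theorem big_nonneg (K x : ℝ≥0) : 0 ≤ big K x := by unfold big; split_ifs <;> simp

theorem small_nonneg (K x : ℝ≥0) : 0 ≤ small K x := by unfold small; split_ifs <;> simp

theorem big_le_one (K x : ℝ≥0) : big K x ≤ 1 := by unfold big; split_ifs <;> simp

theorem small_le_one (K x : ℝ≥0) : small K x ≤ 1 := by unfold small; split_ifs <;> simp

/-- A count of the configurations that can make the degree differ from the number of paths: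
neighbours of `v` of weight larger than `K`, and pairs of common neighbours of `v` and another
vertex with weights at most `K`. -/
noncomputable def excess (K : ℝ≥0) (x : Fin m → ℝ≥0) (v : Fin n) (h : Fin m → Fin n → Bool) : ℝ :=
  ∑ i, big K (x i) * ind (h i v) +
    ∑ j ∈ Finset.univ.erase v, ∑ i, ∑ i' ∈ Finset.univ.erase i,
      small K (x i) * small K (x i') *
        ((ind (h i v) * ind (h i j)) * (ind (h i' v) * ind (h i' j)))

/-- Of two common neighbours `i ≠ i'`, either one is heavier than `K` and is counted in the first
sum, or both are light and the pair is counted in the second. -/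
theorem one_le_excess (K : ℝ≥0) (x : Fin m → ℝ≥0) (v : Fin n) (h : Fin m → Fin n → Bool)
    (hne : (intersectionGraph h).degree v ≠ pathCount v h) : 1 ≤ excess K x v h := by
  obtain ⟨j, hj, i, i', hii, ⟨h1, h2⟩, h3, h4⟩ := exists_ne_of_degree_ne_pathCount v h hne
  have n1 : ∀ i, 0 ≤ big K (x i) * ind (h i v) := fun i =>
    mul_nonneg (big_nonneg _ _) (ind_nonneg _)
  have n2 : ∀ j i i', 0 ≤ small K (x i) * small K (x i') *
      ((ind (h i v) * ind (h i j)) * (ind (h i' v) * ind (h i' j))) := fun j i i' =>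
    mul_nonneg (mul_nonneg (small_nonneg _ _) (small_nonneg _ _))
      (mul_nonneg (mul_nonneg (ind_nonneg _) (ind_nonneg _))
        (mul_nonneg (ind_nonneg _) (ind_nonneg _)))
  have n3 := fun j i => Finset.sum_nonneg fun i' (_ : i' ∈ Finset.univ.erase i) => n2 j i i'
  have n4 := fun j => Finset.sum_nonneg fun i (_ : i ∈ Finset.univ) => n3 j i
  have hbig : ∀ i, h i v = true → K < x i → 1 ≤ excess K x v h := fun i hi hK => by
    have := Finset.single_le_sum (fun i _ => n1 i) (Finset.mem_univ i)
    have h0 := Finset.sum_nonneg fun j (_ : j ∈ Finset.univ.erase v) => n4 j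
    simp only [big, ind, hi, hK, if_true] at this
    unfold excess
    simp only [big, ind] at h0 ⊢
    linarith
  by_cases hK : K < x i
  · exact hbig i h1 hK
  by_cases hK' : K < x i'
  · exact hbig i' h3 hK'
  have s1 := Finset.single_le_sum (fun i' _ => n2 j i i')
    (Finset.mem_erase.2 ⟨hii.symm, Finset.mem_univ i'⟩)
  have s2 := Finset.single_le_sum (fun i _ => n3 j i) (Finset.mem_univ i)
  have s3 := Finset.single_le_sum (fun j _ => n4 j) (Finset.mem_erase.2 ⟨hj, Finset.mem_univ j⟩)
  have h0 := Finset.sum_nonneg fun i (_ : i ∈ Finset.univ) => n1 i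
  have e : small K (x i) * small K (x i') *
      ((ind (h i v) * ind (h i j)) * (ind (h i' v) * ind (h i' j))) = 1 := by
    simp [small, ind, h1, h2, h3, h4, hK, hK']
  unfold excess
  linarith

theorem excess_nonneg (K : ℝ≥0) (x : Fin m → ℝ≥0) (v : Fin n) (h : Fin m → Fin n → Bool) :
    0 ≤ excess K x v h :=
  add_nonneg (Finset.sum_nonneg fun _ _ => mul_nonneg (big_nonneg _ _) (ind_nonneg _))
    (Finset.sum_nonneg fun _ _ => Finset.sum_nonneg fun _ _ => Finset.sum_nonneg fun _ _ =>
      mul_nonneg (mul_nonneg (small_nonneg _ _) (small_nonneg _ _))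
        (mul_nonneg (mul_nonneg (ind_nonneg _) (ind_nonneg _))
          (mul_nonneg (ind_nonneg _) (ind_nonneg _))))

theorem norm_pow_degree_sub_pow_pathCount_le {z : ℂ} (hz : ‖z‖ ≤ 1) (K : ℝ≥0)
    (x : Fin m → ℝ≥0) (v : Fin n) (h : Fin m → Fin n → Bool) :
    ‖z ^ (intersectionGraph h).degree v - z ^ pathCount v h‖ ≤ 2 * excess K x v h := by
  by_cases hne : (intersectionGraph h).degree v = pathCount v h
  · rw [hne, sub_self, norm_zero]
    linarith [excess_nonneg K x v h]
  · have h1 := one_le_excess K x v h hne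
    refine (norm_sub_le _ _).trans ?_
    rw [norm_pow, norm_pow]
    have := pow_le_one₀ (n := (intersectionGraph h).degree v) (norm_nonneg z) hz
    have := pow_le_one₀ (n := pathCount v h) (norm_nonneg z) hz
    linarith

section Row

variable (p : Fin n → I)

theorem integral_ind_row (v : Fin n) :
    ∫ r : Fin n → Bool, ind (r v) ∂Measure.pi (fun j => bernoulliMeasure true false (p j))
      = p v := by
  rw [integral_comp_eval (X := fun _ : Fin n => Bool)
    (μ := fun j => bernoulliMeasure true false (p j)) (f := ind) (by fun_prop), integral_ind]

theorem integral_ind_mul_ind_row {v j : Fin n} (hj : j ≠ v) :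
    ∫ r : Fin n → Bool, ind (r v) * ind (r j)
      ∂Measure.pi (fun j => bernoulliMeasure true false (p j)) = p v * p j := by
  rw [integral_pi_mul_of_ne _ hj.symm (by fun_prop) (by fun_prop), integral_ind, integral_ind]

end Row

/-- The pairs have `i' ≠ i`, so they involve independent rows, and within a row the edges to `v` and
`j ≠ v` are independent. -/
theorem integral_excess (K : ℝ≥0) (x : Fin m → ℝ≥0) (y : Fin n → ℝ≥0) (v : Fin n) :
    ∫ h, excess K x v h ∂bipartiteLaw n m x y
      = ∑ i, big K (x i) * edgeProb n m (x i) (y v) +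
        ∑ j ∈ Finset.univ.erase v, ∑ i, ∑ i' ∈ Finset.univ.erase i,
          (small K (x i) * (edgeProb n m (x i) (y v) * edgeProb n m (x i) (y j))) *
            (small K (x i') * (edgeProb n m (x i') (y v) * edgeProb n m (x i') (y j))) := by
  unfold excess
  rw [integral_add .of_finite .of_finite, integral_finsetSum _ fun _ _ => .of_finite,
    integral_finsetSum _ fun _ _ => .of_finite]
  congr 1
  · refine Finset.sum_congr rfl fun i _ => ?_
    rw [integral_const_mul, bipartiteLaw,
      integral_comp_eval (X := fun _ : Fin m => Fin n → Bool)
        (μ := fun i => Measure.pi fun j => bernoulliMeasure true false (edgeProb n m (x i) (y j)))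
        (f := fun r : Fin n → Bool => ind (r v)) (measurable_of_finite _).aestronglyMeasurable,
      integral_ind_row]
  · refine Finset.sum_congr rfl fun j hj => ?_
    have hjv := Finset.ne_of_mem_erase hj
    rw [integral_finsetSum _ fun _ _ => .of_finite]
    refine Finset.sum_congr rfl fun i _ => ?_
    rw [integral_finsetSum _ fun _ _ => .of_finite]
    refine Finset.sum_congr rfl fun i' hi' => ?_
    rw [integral_const_mul, bipartiteLaw,
      integral_pi_mul_of_ne (E := fun _ : Fin m => Fin n → Bool)
        (fun i => Measure.pi fun j => bernoulliMeasure true false (edgeProb n m (x i) (y j)))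
        (Finset.ne_of_mem_erase hi').symm (f := fun r : Fin n → Bool => ind (r v) * ind (r j))
        (g := fun r : Fin n → Bool => ind (r v) * ind (r j))
        (measurable_of_finite _) (measurable_of_finite _),
      integral_ind_mul_ind_row _ hjv, integral_ind_mul_ind_row _ hjv]
    ring

variable (P : Measure ℝ≥0) [IsProbabilityMeasure P]

theorem integrable_big_mul_edgeProb (K y : ℝ≥0) :
    Integrable (fun x => big K x * edgeProb n m x y) P := by
  refine Integrable.of_bound (C := 1)
    ((measurable_big K).mul (measurable_edgeProb_left y)).aestronglyMeasurable
    (Eventually.of_forall fun x => ?_)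
  rw [Real.norm_of_nonneg (mul_nonneg (big_nonneg _ _) (edgeProb _ _ _ _).2.1)]
  exact mul_le_one₀ (big_le_one _ _) (edgeProb _ _ _ _).2.1 (edgeProb _ _ _ _).2.2

theorem measurable_small_mul (K y y' : ℝ≥0) :
    Measurable (fun x => small K x * ((edgeProb n m x y : ℝ) * edgeProb n m x y')) :=
  (measurable_small K).mul ((measurable_edgeProb_left y).mul (measurable_edgeProb_left y'))

theorem small_mul_nonneg (K y y' x : ℝ≥0) :
    0 ≤ small K x * ((edgeProb n m x y : ℝ) * edgeProb n m x y') :=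
  mul_nonneg (small_nonneg _ _) (mul_nonneg (edgeProb _ _ _ _).2.1 (edgeProb _ _ _ _).2.1)

theorem small_mul_le_one (K y y' x : ℝ≥0) :
    small K x * ((edgeProb n m x y : ℝ) * edgeProb n m x y') ≤ 1 :=
  mul_le_one₀ (small_le_one _ _) (mul_nonneg (edgeProb _ _ _ _).2.1 (edgeProb _ _ _ _).2.1)
    (mul_le_one₀ (edgeProb _ _ _ _).2.2 (edgeProb _ _ _ _).2.1 (edgeProb _ _ _ _).2.2)

theorem integrable_big_mul_edgeProb_comp_eval (K : ℝ≥0) (y : ℝ≥0) (i : Fin m) :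
    Integrable (fun x : Fin m → ℝ≥0 => big K (x i) * (edgeProb n m (x i) y : ℝ))
      (Measure.pi fun _ => P) :=
  integrable_comp_eval (X := fun _ : Fin m => ℝ≥0) (μ := fun _ => P) (i := i)
    (f := fun x => big K x * (edgeProb n m x y : ℝ)) (integrable_big_mul_edgeProb P K y)

theorem integrable_small_mul_small_comp_eval (K y y' : ℝ≥0) (i i' : Fin m) :
    Integrable (fun x : Fin m → ℝ≥0 =>
      (small K (x i) * ((edgeProb n m (x i) y : ℝ) * edgeProb n m (x i) y')) *
        (small K (x i') * (edgeProb n m (x i') y * edgeProb n m (x i') y')))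
      (Measure.pi fun _ => P) := by
  refine Integrable.of_bound (C := 1)
    (((measurable_small_mul K y y').comp (measurable_pi_apply i)).mul
      ((measurable_small_mul K y y').comp (measurable_pi_apply i'))).aestronglyMeasurable
    (Eventually.of_forall fun x => ?_)
  rw [Real.norm_of_nonneg (mul_nonneg (small_mul_nonneg _ _ _ _) (small_mul_nonneg _ _ _ _))]
  exact mul_le_one₀ (small_mul_le_one _ _ _ _) (small_mul_nonneg _ _ _ _)
    (small_mul_le_one _ _ _ _)

theorem integrable_integral_excess (K : ℝ≥0) (y : Fin n → ℝ≥0) (v : Fin n) :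
    Integrable (fun x => ∫ h, excess K x v h ∂bipartiteLaw n m x y)
      (Measure.pi fun _ : Fin m => P) := by
  simp only [integral_excess]
  exact (integrable_finsetSum _ fun i _ => integrable_big_mul_edgeProb_comp_eval P K (y v) i).add
    (integrable_finsetSum _ fun j _ => integrable_finsetSum _ fun i _ =>
      integrable_finsetSum _ fun i' _ =>
        integrable_small_mul_small_comp_eval P K (y v) (y j) i i')

theorem integral_integral_excess_le (K : ℝ≥0) (y : Fin n → ℝ≥0) (v : Fin n) :
    ∫ x, ∫ h, excess K x v h ∂bipartiteLaw n m x y ∂Measure.pi (fun _ : Fin m => P)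
      ≤ m * ∫ x, big K x * edgeProb n m x (y v) ∂P +
        ∑ j ∈ Finset.univ.erase v,
          (m * ∫ x, small K x * (edgeProb n m x (y v) * edgeProb n m x (y j)) ∂P) ^ 2 := by
  simp only [integral_excess]
  have hint1 := fun i => integrable_big_mul_edgeProb_comp_eval (n := n) (m := m) P K (y v) i
  have hint2 := fun (j : Fin n) i i' =>
    integrable_small_mul_small_comp_eval (n := n) (m := m) P K (y v) (y j) i i'
  rw [integral_add (integrable_finsetSum _ fun i _ => hint1 i)
    (integrable_finsetSum _ fun j _ => integrable_finsetSum _ fun i _ =>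
      integrable_finsetSum _ fun i' _ => hint2 j i i'),
    integral_finsetSum _ fun i _ => hint1 i,
    integral_finsetSum _ fun j _ => integrable_finsetSum _ fun i _ =>
      integrable_finsetSum _ fun i' _ => hint2 j i i']
  refine add_le_add (le_of_eq ?_) (Finset.sum_le_sum fun j _ => ?_)
  · have : ∀ i : Fin m, ∫ x : Fin m → ℝ≥0, big K (x i) * (edgeProb n m (x i) (y v) : ℝ)
        ∂Measure.pi (fun _ => P) = ∫ x, big K x * edgeProb n m x (y v) ∂P := fun i =>
      integral_comp_eval (X := fun _ : Fin m => ℝ≥0) (μ := fun _ => P) (i := i)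
        (f := fun x => big K x * (edgeProb n m x (y v) : ℝ))
        (integrable_big_mul_edgeProb P K (y v)).aestronglyMeasurable
    simp [this]
  · rw [integral_finsetSum _ fun i _ => integrable_finsetSum _ fun i' _ => hint2 j i i']
    set q := ∫ x, small K x * ((edgeProb n m x (y v) : ℝ) * edgeProb n m x (y j)) ∂P with hq
    have hle : ∀ i : Fin m, ∫ x : Fin m → ℝ≥0, ∑ i' ∈ Finset.univ.erase i,
        (small K (x i) * ((edgeProb n m (x i) (y v) : ℝ) * edgeProb n m (x i) (y j))) *
          (small K (x i') * (edgeProb n m (x i') (y v) * edgeProb n m (x i') (y j)))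
        ∂Measure.pi (fun _ => P) ≤ m * q ^ 2 := by
      intro i
      rw [integral_finsetSum _ fun i' _ => hint2 j i i']
      have : ∀ i' ∈ Finset.univ.erase i, ∫ x : Fin m → ℝ≥0,
          (small K (x i) * ((edgeProb n m (x i) (y v) : ℝ) * edgeProb n m (x i) (y j))) *
            (small K (x i') * (edgeProb n m (x i') (y v) * edgeProb n m (x i') (y j)))
          ∂Measure.pi (fun _ => P) = q ^ 2 := fun i' hi' => by
        rw [integral_pi_mul_of_ne (fun _ : Fin m => P) (Finset.ne_of_mem_erase hi').symm
          (measurable_small_mul K (y v) (y j)) (measurable_small_mul K (y v) (y j)), sq]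
      rw [Finset.sum_congr rfl this, Finset.sum_const, nsmul_eq_mul]
      refine mul_le_mul_of_nonneg_right ?_ (sq_nonneg q)
      exact_mod_cast (Finset.card_le_univ _).trans_eq (Fintype.card_fin m)
    refine (Finset.sum_le_sum fun i _ => hle i).trans (le_of_eq ?_)
    simp
    ring

end RIG

/-! ### One infinite weight sequence for all sizes, and the strong law -/

/-- This lets the weights of `V` for every `n` be read off a single sequence, so that an almost sure
statement about that sequence applies along the whole array. -/
theorem map_infinitePi_fin {α : Type*} {mα : MeasurableSpace α} (P : Measure α)
    [IsProbabilityMeasure P] (n : ℕ) :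
    (Measure.infinitePi fun _ : ℕ => P).map (fun ω (j : Fin n) => ω j)
      = Measure.pi fun _ => P := by
  have h1 : iIndepFun (fun (i : ℕ) (ω : ℕ → α) => ω i) (Measure.infinitePi fun _ : ℕ => P) :=
    iIndepFun_infinitePi (P := fun _ : ℕ => P) (X := fun _ => (id : α → α)) fun _ => measurable_id
  have h2 : iIndepFun (fun (j : Fin n) (ω : ℕ → α) => ω j) (Measure.infinitePi fun _ : ℕ => P) :=
    h1.precomp (Fin.val_injective (n := n))
  have h3 := (iIndepFun_iff_map_fun_eq_pi_map fun j : Fin n =>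
    (measurable_pi_apply (j : ℕ)).aemeasurable).1 h2
  rw [h3]
  congr 1
  funext j
  exact Measure.infinitePi_map_eval (fun _ : ℕ => P) j

theorem integrable_coe_nnreal {P : Measure ℝ≥0} (hP : ∫⁻ x, (x : ℝ≥0∞) ∂P < ∞) :
    Integrable (fun x : ℝ≥0 => (x : ℝ)) P := by
  refine ⟨by fun_prop, ?_⟩
  simpa [HasFiniteIntegral, enorm_eq_nnnorm] using hP

theorem integral_coe_nnreal_eq_mean (P : Measure ℝ≥0) : ∫ x, (x : ℝ) ∂P = RIG.mean P := by
  rw [integral_eq_lintegral_of_nonneg_ae (Eventually.of_forall fun x => x.coe_nonneg)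
    (by fun_prop)]
  simp only [RIG.mean, ENNReal.ofReal_coe_nnreal]
  rfl

/-- The strong law of large numbers on the infinite product space. -/
theorem ae_tendsto_average {P : Measure ℝ≥0} [IsProbabilityMeasure P]
    (hP : ∫⁻ x, (x : ℝ≥0∞) ∂P < ∞) :
    ∀ᵐ ω ∂Measure.infinitePi (fun _ : ℕ => P),
      Tendsto (fun N : ℕ => (∑ i ∈ Finset.range N, (ω i : ℝ)) / N) atTop
        (𝓝 (RIG.mean P : ℝ)) := by
  have hmap : ∀ i : ℕ, (Measure.infinitePi fun _ : ℕ => P).map (fun ω => ω i) = P := fun i =>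
    Measure.infinitePi_map_eval (fun _ : ℕ => P) i
  have hind : iIndepFun (fun (i : ℕ) (ω : ℕ → ℝ≥0) => (ω i : ℝ))
      (Measure.infinitePi fun _ : ℕ => P) :=
    iIndepFun_infinitePi (P := fun _ : ℕ => P) (X := fun _ (x : ℝ≥0) => (x : ℝ))
      fun _ => by fun_prop
  have hval : ∫ ω, (ω 0 : ℝ) ∂Measure.infinitePi (fun _ : ℕ => P) = RIG.mean P := by
    rw [← integral_coe_nnreal_eq_mean]
    conv_rhs => rw [← hmap 0]
    rw [integral_map (measurable_pi_apply 0).aemeasurable (by fun_prop)]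
  rw [← hval]
  refine strong_law_ae_real (fun i (ω : ℕ → ℝ≥0) => (ω i : ℝ)) ?_
    (fun i j hij => hind.indepFun hij) fun i => ?_
  · have := integrable_coe_nnreal hP
    rw [← hmap 0] at this
    exact this.comp_measurable (by fun_prop)
  · have hm : ∀ i : ℕ, Measurable fun ω : ℕ → ℝ≥0 => (ω i : ℝ) := fun i => by fun_prop
    refine ⟨(hm i).aemeasurable, (hm 0).aemeasurable, ?_⟩
    have h : ∀ i : ℕ, (Measure.infinitePi fun _ : ℕ => P).map (fun ω => (ω i : ℝ))
        = P.map fun x : ℝ≥0 => (x : ℝ) := fun i => by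
      conv_rhs => rw [← hmap i]
      rw [Measure.map_map (by fun_prop) (by fun_prop)]
      rfl
    rw [h, h]

/-! ### Conditional expectations given the weights of `V` -/

namespace RIG

section Transfer

variable {n m : ℕ} (P₁ P₂ : Measure ℝ≥0) [IsProbabilityMeasure P₁] [IsProbabilityMeasure P₂]

/-- The conditional expectation of a function of the bipartite graph given `Y = y`. -/
noncomputable def condMean (F : (Fin m → Fin n → Bool) → ℂ) (y : Fin n → ℝ≥0) : ℂ :=
  ∫ x, ∫ h, F h ∂bipartiteLaw n m x y ∂Measure.pi (fun _ : Fin m => P₁)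

theorem stronglyMeasurable_integral_bipartiteLaw (F : (Fin m → Fin n → Bool) → ℂ) :
    StronglyMeasurable fun p : (Fin m → ℝ≥0) × (Fin n → ℝ≥0) =>
      ∫ h, F h ∂bipartiteLaw n m p.1 p.2 :=
  StronglyMeasurable.integral_kernel (κ := bipartiteKernel n m)
    (measurable_of_finite F).stronglyMeasurable

theorem stronglyMeasurable_condMean (F : (Fin m → Fin n → Bool) → ℂ) :
    StronglyMeasurable (condMean P₁ F : (Fin n → ℝ≥0) → ℂ) :=
  (stronglyMeasurable_integral_bipartiteLaw F).integral_prod_left'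

theorem norm_condMean_le {F : (Fin m → Fin n → Bool) → ℂ} (hF : ∀ h, ‖F h‖ ≤ 1)
    (y : Fin n → ℝ≥0) : ‖condMean P₁ F y‖ ≤ 1 := by
  have h1 : ∀ x, ‖∫ h, F h ∂bipartiteLaw n m x y‖ ≤ 1 := fun x => by
    simpa using norm_integral_le_of_norm_le_const (μ := bipartiteLaw n m x y)
      (Eventually.of_forall hF)
  simpa [condMean] using norm_integral_le_of_norm_le_const (μ := Measure.pi fun _ : Fin m => P₁)
      (Eventually.of_forall h1)

theorem integrable_integral_bipartiteLaw {F : (Fin m → Fin n → Bool) → ℂ} (hF : ∀ h, ‖F h‖ ≤ 1)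
    (y : Fin n → ℝ≥0) :
    Integrable (fun x => ∫ h, F h ∂bipartiteLaw n m x y) (Measure.pi fun _ : Fin m => P₁) := by
  refine Integrable.of_bound (C := 1) ?_ (Eventually.of_forall fun x => ?_)
  · exact ((stronglyMeasurable_integral_bipartiteLaw F).comp_measurable
      (measurable_id.prodMk measurable_const)).aestronglyMeasurable
  · simpa using norm_integral_le_of_norm_le_const (μ := bipartiteLaw n m x y)
      (Eventually.of_forall hF)

theorem integral_modelLaw {F : (Fin m → Fin n → Bool) → ℂ} (hF : ∀ h, ‖F h‖ ≤ 1) :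
    ∫ ω, F ω.2 ∂modelLaw P₁ P₂ n m
      = ∫ ω, condMean P₁ F (fun j : Fin n => ω j) ∂Measure.infinitePi (fun _ : ℕ => P₂) := by
  have hFm : Measurable F := measurable_of_finite F
  have h1 : Integrable (fun ω : ((Fin m → ℝ≥0) × (Fin n → ℝ≥0)) × (Fin m → Fin n → Bool) =>
      F ω.2) (modelLaw P₁ P₂ n m) :=
    Integrable.of_bound (C := 1) (hFm.comp measurable_snd).aestronglyMeasurable
      (Eventually.of_forall fun ω => hF _)
  have h2 : Integrable (fun p : (Fin m → ℝ≥0) × (Fin n → ℝ≥0) =>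
      ∫ h, F h ∂bipartiteLaw n m p.1 p.2)
      ((Measure.pi fun _ => P₁).prod (Measure.pi fun _ => P₂)) := by
    refine Integrable.of_bound (C := 1)
      (stronglyMeasurable_integral_bipartiteLaw F).aestronglyMeasurable
      (Eventually.of_forall fun p => ?_)
    simpa using norm_integral_le_of_norm_le_const (μ := bipartiteLaw n m p.1 p.2)
      (Eventually.of_forall hF)
  rw [modelLaw] at h1 ⊢
  rw [Measure.integral_compProd h1]
  change ∫ p : (Fin m → ℝ≥0) × (Fin n → ℝ≥0), ∫ h, F h ∂bipartiteLaw n m p.1 p.2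
    ∂((Measure.pi fun _ => P₁).prod (Measure.pi fun _ => P₂)) = _
  rw [integral_prod_symm _ h2, ← map_infinitePi_fin P₂ n,
    integral_map (measurable_pi_lambda _ fun j => measurable_pi_apply _).aemeasurable]
  · rfl
  · exact (stronglyMeasurable_condMean P₁ F).aestronglyMeasurable

theorem norm_condMean_degree_sub_pathCount_le {z : ℂ} (hz : ‖z‖ ≤ 1) (K : ℝ≥0)
    (y : Fin n → ℝ≥0) (v : Fin n) :
    ‖condMean P₁ (fun h : Fin m → Fin n → Bool => z ^ (intersectionGraph h).degree v) y
      - condMean P₁ (fun h : Fin m → Fin n → Bool => z ^ pathCount v h) y‖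
      ≤ 2 * ∫ x, ∫ h, excess K x v h ∂bipartiteLaw n m x y ∂Measure.pi (fun _ : Fin m => P₁) := by
  have hpow : ∀ d : ℕ, ‖z ^ d‖ ≤ 1 := fun d => by
    rw [norm_pow]; exact pow_le_one₀ (norm_nonneg z) hz
  rw [condMean, condMean, ← integral_sub (integrable_integral_bipartiteLaw P₁ (fun h => hpow _) y)
    (integrable_integral_bipartiteLaw P₁ (fun h => hpow _) y), ← integral_const_mul]
  refine norm_integral_le_of_norm_le ?_ (Eventually.of_forall fun x => ?_)
  · exact (integrable_integral_excess P₁ K y v).const_mul 2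
  · rw [← integral_sub .of_finite .of_finite, ← integral_const_mul]
    exact norm_integral_le_of_norm_le .of_finite (Eventually.of_forall fun h =>
      norm_pow_degree_sub_pow_pathCount_le hz K x v h)

end Transfer

end RIG

/-! ### Passage to the limit -/

namespace RIG

/-- The exponent, per unit of weight of the vertex, of the generating function of the limit. -/
noncomputable def limitRate (P : Measure ℝ≥0) (c : ℝ) (z : ℂ) : ℂ :=
  ∫ x : ℝ≥0, (x : ℝ) * (1 - Complex.exp (-((x * c : ℝ) * (1 - z)))) ∂P

section Limits

variable {P : Measure ℝ≥0} {β : ℝ} {n m : ℕ → ℕ}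

theorem tendsto_integral_big_mul (hP : ∫⁻ x, (x : ℝ≥0∞) ∂P < ∞) :
    Tendsto (fun K : ℕ => ∫ x : ℝ≥0, big K x * (x : ℝ) ∂P) atTop (𝓝 0) := by
  have h : Tendsto (fun K : ℕ => ∫ x : ℝ≥0, big K x * (x : ℝ) ∂P) atTop
      (𝓝 (∫ _ : ℝ≥0, (0 : ℝ) ∂P)) := by
    refine tendsto_integral_of_dominated_convergence (fun x : ℝ≥0 => (x : ℝ))
      (fun K => ((measurable_big _).mul (by fun_prop)).aestronglyMeasurable)
      (integrable_coe_nnreal hP) (fun K => Eventually.of_forall fun x => ?_)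
      (Eventually.of_forall fun x => ?_)
    · rw [Real.norm_of_nonneg (mul_nonneg (big_nonneg _ _) x.coe_nonneg)]
      exact mul_le_of_le_one_left x.coe_nonneg (big_le_one _ _)
    · obtain ⟨N, hN⟩ := exists_nat_ge x
      refine tendsto_const_nhds.congr' ?_
      filter_upwards [eventually_ge_atTop N] with K hK
      have : x ≤ (K : ℝ≥0) := hN.trans (by exact_mod_cast hK)
      simp [big, not_lt.2 this]
  simpa using h

variable [IsProbabilityMeasure P]

/-- Dominated convergence in the weight `x`: as `m / √(nm)` is eventually below `√β + 1`, the
integrand is bounded by a multiple of `x`, integrable by the first moment alone. -/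
theorem tendsto_mul_integral_offspringGen (hP : ∫⁻ x, (x : ℝ≥0∞) ∂P < ∞)
    (hβ : 0 < β) (hpos : ∀ k, 0 < n k) (hn : Tendsto n atTop atTop)
    (hnm : Tendsto (fun k => (m k : ℝ) / (n k : ℝ)) atTop (𝓝 β)) {y : ℕ → ℝ≥0} {b : ℝ}
    (hb : Tendsto (fun N : ℕ => (∑ i ∈ Finset.range N, (y i : ℝ)) / N) atTop (𝓝 b))
    {z : ℂ} (hz : ‖z‖ ≤ 1) :
    Tendsto (fun k => (m k : ℂ) * ∫ x, (edgeProb (n k) (m k) x (y 0) : ℝ) *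
        (1 - offspringGen (n k) (m k) y z x) ∂P) atTop
      (𝓝 ((Real.sqrt β * y 0 : ℝ) * limitRate P (b / Real.sqrt β) z)) := by
  simp only [limitRate, ← integral_const_mul]
  refine tendsto_integral_filter_of_dominated_convergence
    (fun x : ℝ≥0 => 2 * ((Real.sqrt β + 1) * y 0) * (x : ℝ)) ?_ ?_
    ((integrable_coe_nnreal hP).const_mul _) ?_
  · exact Eventually.of_forall fun k =>
      (integrable_edgeProb_mul_one_sub_offspringGen P hz y).aestronglyMeasurable.const_mul _
  · filter_upwards [(tendsto_div_sqrt_mul hβ hpos hnm).eventually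
      (ge_mem_nhds (lt_add_one (Real.sqrt β)))] with k hk
    refine Eventually.of_forall fun x => ?_
    rw [norm_mul, Complex.norm_natCast]
    calc (m k : ℝ) * ‖(edgeProb (n k) (m k) x (y 0) : ℝ) * (1 - offspringGen (n k) (m k) y z x)‖
        ≤ m k * (2 * (x * y 0 / Real.sqrt (n k * m k))) := by
          gcongr
          refine (norm_edgeProb_mul_one_sub_offspringGen_le hz y x).trans ?_
          gcongr
          exact edgeProb_le_div _ _ _ _
      _ = 2 * (m k / Real.sqrt (n k * m k) * y 0) * x := by ring
      _ ≤ _ := by gcongr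
  · refine Eventually.of_forall fun x => ?_
    have h1 := (Complex.continuous_ofReal.tendsto _).comp
      (tendsto_mul_edgeProb hβ hpos hn hnm hb x)
    have h2 := h1.mul ((tendsto_offspringGen hβ hpos hn hnm hb hz x).const_sub 1)
    convert h2 using 2 with k
    · simp only [Function.comp_apply]
      push_cast
      ring
    · push_cast
      ring

theorem tendsto_condMean_pathCount (hP : ∫⁻ x, (x : ℝ≥0∞) ∂P < ∞)
    (hβ : 0 < β) (hpos : ∀ k, 0 < n k) (hn : Tendsto n atTop atTop) (hm : Tendsto m atTop atTop)
    (hnm : Tendsto (fun k => (m k : ℝ) / (n k : ℝ)) atTop (𝓝 β)) {y : ℕ → ℝ≥0} {b : ℝ}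
    (hb : Tendsto (fun N : ℕ => (∑ i ∈ Finset.range N, (y i : ℝ)) / N) atTop (𝓝 b))
    {z : ℂ} (hz : ‖z‖ ≤ 1) :
    Tendsto (fun k => condMean P (fun h : Fin (m k) → Fin (n k) → Bool =>
        z ^ pathCount ⟨0, hpos k⟩ h) (fun j => y j)) atTop
      (𝓝 (Complex.exp (-((Real.sqrt β * y 0 : ℝ) * limitRate P (b / Real.sqrt β) z)))) := by
  simp only [condMean, integral_integral_pow_pathCount P (hpos _) y hz]
  refine tendsto_one_sub_pow hm (fun k => ?_)
    (tendsto_mul_integral_offspringGen hP hβ hpos hn hnm hb hz)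
  -- The base of the power is an average of points of the unit disc.
  have h := norm_integral_le_of_norm_le_const (μ := P) (C := 1)
    (f := fun x => 1 - (edgeProb (n k) (m k) x (y 0) : ℝ) *
      (1 - offspringGen (n k) (m k) y z x))
    (Eventually.of_forall fun x => norm_one_sub_mul_le (norm_offspringGen_le hz _ _ y x) _)
  rw [integral_sub (integrable_const _) (integrable_edgeProb_mul_one_sub_offspringGen P hz y)] at h
  simpa using h

theorem mul_integral_big_mul_edgeProb_le (hP : ∫⁻ x, (x : ℝ≥0∞) ∂P < ∞) (K y : ℝ≥0) (n m : ℕ) :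
    m * ∫ x, big K x * edgeProb n m x y ∂P
      ≤ m / Real.sqrt (n * m) * (y * ∫ x : ℝ≥0, big K x * (x : ℝ) ∂P) := by
  have hint : Integrable (fun x : ℝ≥0 => big K x * (x : ℝ)) P := by
    refine (integrable_coe_nnreal hP).mono'
      ((measurable_big _).mul (by fun_prop)).aestronglyMeasurable
      (Eventually.of_forall fun x => ?_)
    rw [Real.norm_of_nonneg (mul_nonneg (big_nonneg _ _) x.coe_nonneg)]
    exact mul_le_of_le_one_left x.coe_nonneg (big_le_one _ _)
  have h : ∫ x, big K x * edgeProb n m x y ∂P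
      ≤ ∫ x : ℝ≥0, y / Real.sqrt (n * m) * (big K x * (x : ℝ)) ∂P := by
    refine integral_mono (integrable_big_mul_edgeProb P K y) (hint.const_mul _) fun x => ?_
    calc big K x * (edgeProb n m x y : ℝ) ≤ big K x * (x * y / Real.sqrt (n * m)) :=
          mul_le_mul_of_nonneg_left (edgeProb_le_div _ _ _ _) (big_nonneg _ _)
      _ = _ := by ring
  rw [integral_const_mul] at h
  calc (m : ℝ) * ∫ x, big K x * edgeProb n m x y ∂P
      ≤ m * (y / Real.sqrt (n * m) * ∫ x : ℝ≥0, big K x * (x : ℝ) ∂P) := by gcongr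
    _ = _ := by ring

/-- The product of two edge probabilities is quadratic in `x`; the cutoff `x ≤ K` stands in for a
second moment. -/
theorem mul_integral_small_mul_le (K y y' : ℝ≥0) {n : ℕ} (hn : 0 < n) (m : ℕ) :
    m * ∫ x, small K x * ((edgeProb n m x y : ℝ) * edgeProb n m x y') ∂P
      ≤ K ^ 2 * y * y' / n := by
  have h : ∫ x, small K x * ((edgeProb n m x y : ℝ) * edgeProb n m x y') ∂P
      ≤ ∫ _ : ℝ≥0, (K : ℝ) ^ 2 * y * y' / (n * m) ∂P := by
    refine integral_mono (Integrable.of_bound (C := 1)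
      (measurable_small_mul K y y').aestronglyMeasurable
      (Eventually.of_forall fun x => ?_)) (integrable_const _) fun x => ?_
    · rw [Real.norm_of_nonneg (small_mul_nonneg _ _ _ _)]
      exact small_mul_le_one _ _ _ _
    · by_cases hK : K < x
      · simp only [small, hK, if_true, zero_mul]
        positivity
      · simp only [small, hK, if_false, one_mul]
        have hx : (x : ℝ) ≤ K := by exact_mod_cast not_lt.1 hK
        calc (edgeProb n m x y : ℝ) * edgeProb n m x y'
            ≤ (x * y / Real.sqrt (n * m)) * (x * y' / Real.sqrt (n * m)) :=
              mul_le_mul (edgeProb_le_div _ _ _ _) (edgeProb_le_div _ _ _ _)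
                (edgeProb _ _ _ _).2.1 (by positivity)
          _ = (x : ℝ) ^ 2 * y * y' / (Real.sqrt (n * m) * Real.sqrt (n * m)) := by ring
          _ = (x : ℝ) ^ 2 * y * y' / (n * m) := by rw [Real.mul_self_sqrt (by positivity)]
          _ ≤ _ := by gcongr
  simp only [integral_const, probReal_univ, one_smul] at h
  have hn' : (0 : ℝ) < n := by exact_mod_cast hn
  -- Cancelling `m` against `n * m` requires `m ≠ 0`.
  rcases eq_or_ne m 0 with rfl | hm
  · simp only [Nat.cast_zero, zero_mul]
    positivity
  · have hm' : (m : ℝ) ≠ 0 := by exact_mod_cast hm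
    calc (m : ℝ) * ∫ x, small K x * ((edgeProb n m x y : ℝ) * edgeProb n m x y') ∂P
        ≤ m * ((K : ℝ) ^ 2 * y * y' / (n * m)) := by gcongr
      _ = _ := by field_simp

theorem sum_sq_mul_integral_small_mul_le (K : ℝ≥0) (y : ℕ → ℝ≥0) {n : ℕ} (hn : 0 < n) (m : ℕ) :
    ∑ j ∈ (Finset.univ : Finset (Fin n)).erase ⟨0, hn⟩,
        (m * ∫ x, small K x * ((edgeProb n m x (y 0) : ℝ) * edgeProb n m x (y j)) ∂P) ^ 2
      ≤ ((K : ℝ) ^ 2 * y 0) ^ 2 * ((∑ j ∈ Finset.range n, (y j : ℝ) ^ 2) / (n : ℝ) ^ 2) := by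
  calc _ ≤ ∑ j ∈ (Finset.univ : Finset (Fin n)).erase ⟨0, hn⟩,
        ((K : ℝ) ^ 2 * y 0 * y j / n) ^ 2 := by
        refine Finset.sum_le_sum fun j _ => pow_le_pow_left₀ ?_ ?_ 2
        · exact mul_nonneg (Nat.cast_nonneg _)
            (integral_nonneg fun x => small_mul_nonneg _ _ _ _)
        · exact mul_integral_small_mul_le K (y 0) (y j) hn m
    _ ≤ ∑ j : Fin n, ((K : ℝ) ^ 2 * y 0 * y j / n) ^ 2 :=
        Finset.sum_le_sum_of_subset_of_nonneg (Finset.erase_subset _ _)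
          fun j _ _ => sq_nonneg _
    _ = _ := by
        rw [Finset.sum_range, Finset.sum_div, Finset.mul_sum]
        exact Finset.sum_congr rfl fun j _ => by ring

theorem tendsto_condMean_degree_sub_pathCount (hP : ∫⁻ x, (x : ℝ≥0∞) ∂P < ∞)
    (hβ : 0 < β) (hpos : ∀ k, 0 < n k) (hn : Tendsto n atTop atTop)
    (hnm : Tendsto (fun k => (m k : ℝ) / (n k : ℝ)) atTop (𝓝 β)) {y : ℕ → ℝ≥0} {b : ℝ}
    (hb : Tendsto (fun N : ℕ => (∑ i ∈ Finset.range N, (y i : ℝ)) / N) atTop (𝓝 b))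
    {z : ℂ} (hz : ‖z‖ ≤ 1) :
    Tendsto (fun k =>
      condMean P (fun h : Fin (m k) → Fin (n k) → Bool =>
          z ^ (intersectionGraph h).degree ⟨0, hpos k⟩) (fun j => y j) -
        condMean P (fun h : Fin (m k) → Fin (n k) → Bool =>
          z ^ pathCount ⟨0, hpos k⟩ h) (fun j => y j)) atTop (𝓝 0) := by
  rw [Metric.tendsto_nhds]
  intro ε hε
  have h1 : Tendsto (fun K : ℕ =>
      2 * (Real.sqrt β * (y 0 * ∫ x : ℝ≥0, big K x * (x : ℝ) ∂P))) atTop (𝓝 0) := by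
    simpa using (((tendsto_integral_big_mul hP).const_mul (y 0 : ℝ)).const_mul
      (Real.sqrt β)).const_mul 2
  -- `K` is chosen first, to make the limiting contribution of heavy neighbours less than `ε`; with
  -- `K` fixed, the contribution of light pairs vanishes as `k → ∞`.
  obtain ⟨K, hK⟩ := (h1.eventually (gt_mem_nhds hε)).exists
  have h2 := (((tendsto_div_sqrt_mul hβ hpos hnm).mul_const
    ((y 0 : ℝ) * ∫ x : ℝ≥0, big K x * (x : ℝ) ∂P)).add
      (((tendsto_sum_sq_div_sq (fun i => (y i).coe_nonneg) hb).comp hn).const_mul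
        ((((K : ℝ≥0) : ℝ) ^ 2 * y 0) ^ 2))).const_mul 2
  rw [mul_zero, add_zero] at h2
  filter_upwards [h2.eventually (gt_mem_nhds hK)] with k hk
  rw [dist_zero_right]
  refine lt_of_le_of_lt ((norm_condMean_degree_sub_pathCount_le P hz K _ _).trans
    (mul_le_mul_of_nonneg_left ((integral_integral_excess_le P K _ _).trans
      (add_le_add ?_ ?_)) zero_le_two)) hk
  · exact mul_integral_big_mul_edgeProb_le hP K (y 0) (n k) (m k)
  · exact sum_sq_mul_integral_small_mul_le K y (hpos k) (m k)

theorem tendsto_condMean_degree (hP : ∫⁻ x, (x : ℝ≥0∞) ∂P < ∞)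
    (hβ : 0 < β) (hpos : ∀ k, 0 < n k) (hn : Tendsto n atTop atTop) (hm : Tendsto m atTop atTop)
    (hnm : Tendsto (fun k => (m k : ℝ) / (n k : ℝ)) atTop (𝓝 β)) {y : ℕ → ℝ≥0} {b : ℝ}
    (hb : Tendsto (fun N : ℕ => (∑ i ∈ Finset.range N, (y i : ℝ)) / N) atTop (𝓝 b))
    {z : ℂ} (hz : ‖z‖ ≤ 1) :
    Tendsto (fun k => condMean P (fun h : Fin (m k) → Fin (n k) → Bool =>
        z ^ (intersectionGraph h).degree ⟨0, hpos k⟩) (fun j => y j)) atTop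
      (𝓝 (Complex.exp (-((Real.sqrt β * y 0 : ℝ) * limitRate P (b / Real.sqrt β) z)))) := by
  simpa using (tendsto_condMean_degree_sub_pathCount hP hβ hpos hn hnm hb hz).add
    (tendsto_condMean_pathCount hP hβ hpos hn hm hnm hb hz)

theorem tendsto_integral_modelLaw_pow_degree {P₂ : Measure ℝ≥0} [IsProbabilityMeasure P₂]
    (hP : ∫⁻ x, (x : ℝ≥0∞) ∂P < ∞) (hP₂ : ∫⁻ x, (x : ℝ≥0∞) ∂P₂ < ∞)
    (hβ : 0 < β) (hpos : ∀ k, 0 < n k) (hn : Tendsto n atTop atTop) (hm : Tendsto m atTop atTop)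
    (hnm : Tendsto (fun k => (m k : ℝ) / (n k : ℝ)) atTop (𝓝 β)) {z : ℂ} (hz : ‖z‖ ≤ 1) :
    Tendsto (fun k => ∫ ω, z ^ (intersectionGraph ω.2).degree ⟨0, hpos k⟩
        ∂modelLaw P P₂ (n k) (m k)) atTop
      (𝓝 (∫ y : ℝ≥0, Complex.exp (-((Real.sqrt β * y : ℝ) *
        limitRate P (mean P₂ / Real.sqrt β) z)) ∂P₂)) := by
  have hpow : ∀ d : ℕ, ‖z ^ d‖ ≤ 1 := fun d => by
    rw [norm_pow]; exact pow_le_one₀ (norm_nonneg z) hz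
  have hmod := fun k => integral_modelLaw P P₂
    (F := fun h : Fin (m k) → Fin (n k) → Bool => z ^ (intersectionGraph h).degree ⟨0, hpos k⟩)
    fun h => hpow _
  simp only [hmod]
  have hlim : ∫ y : ℝ≥0, Complex.exp (-((Real.sqrt β * y : ℝ) *
        limitRate P (mean P₂ / Real.sqrt β) z)) ∂P₂
      = ∫ ω : ℕ → ℝ≥0, Complex.exp (-((Real.sqrt β * ω 0 : ℝ) *
        limitRate P (mean P₂ / Real.sqrt β) z)) ∂Measure.infinitePi (fun _ : ℕ => P₂) := by
    set r := limitRate P (mean P₂ / Real.sqrt β) z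
    conv_lhs => rw [← Measure.infinitePi_map_eval (fun _ : ℕ => P₂) 0]
    rw [integral_map (measurable_pi_apply 0).aemeasurable (by fun_prop)]
  rw [hlim]
  refine tendsto_integral_of_dominated_convergence (fun _ => 1) (fun k => ?_)
    (integrable_const _) (fun k => Eventually.of_forall fun ω => ?_) ?_
  · have hmeas : Measurable fun (ω : ℕ → ℝ≥0) (j : Fin (n k)) => ω j :=
      measurable_pi_lambda _ fun j => measurable_pi_apply _
    exact ((stronglyMeasurable_condMean P _).comp_measurable hmeas).aestronglyMeasurable
  · exact norm_condMean_le P (fun h => hpow _) _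
  · filter_upwards [ae_tendsto_average hP₂] with ω hω
    exact tendsto_condMean_degree hP hβ hpos hn hm hnm hω hz

end Limits

end RIG

/-! ### Generating function of the limit -/

namespace RIG

/-- The probability that a Poisson variable of mean `x c` equals `r`. -/
noncomputable def poissonWeight (c : ℝ≥0) (r : ℕ) (x : ℝ≥0) : ℝ :=
  Real.exp (-((x * c : ℝ≥0) : ℝ)) * ((x * c : ℝ≥0) : ℝ) ^ r / (r.factorial : ℝ)

theorem poissonWeight_nonneg (c : ℝ≥0) (r : ℕ) (x : ℝ≥0) : 0 ≤ poissonWeight c r x := by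
  unfold poissonWeight; positivity

theorem measurable_poissonWeight (c : ℝ≥0) (r : ℕ) : Measurable (poissonWeight c r) := by
  unfold poissonWeight; fun_prop

theorem hasSum_poissonWeight (c x : ℝ≥0) : HasSum (fun r => poissonWeight c r x) 1 :=
  hasSum_one_poissonMeasure (x * c)

/-- Size-biasing and shifting a Poisson law only multiplies it by its mean; for a mixture this
becomes reweighting the mixing law by `x`. -/
theorem succ_mul_poissonWeight (c : ℝ≥0) (r : ℕ) (x : ℝ≥0) :
    ((r : ℝ) + 1) * poissonWeight c (r + 1) x = (x * c : ℝ) * poissonWeight c r x := by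
  unfold poissonWeight
  rw [Nat.factorial_succ]
  push_cast
  field_simp
  ring

theorem hasSum_poissonWeight_mul_pow (c x : ℝ≥0) (z : ℂ) :
    HasSum (fun r => (poissonWeight c r x : ℂ) * z ^ r)
      (Complex.exp (-((x * c : ℝ) * (1 - z)))) := by
  have h := (NormedSpace.expSeries_div_hasSum_exp (𝔸 := ℂ) ((x * c : ℝ) * z)).mul_left
    (Complex.exp (-(x * c : ℝ)))
  rw [← Complex.exp_eq_exp_ℂ, ← Complex.exp_add] at h
  convert! h using 1
  · funext r
    simp only [poissonWeight]
    push_cast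
    rw [mul_pow]
    ring
  · congr 1
    ring

section Mixture

theorem integrable_mul_poissonWeight {P : Measure ℝ≥0} {q : ℝ≥0 → ℝ} (hq : Integrable q P) (c : ℝ≥0) (r : ℕ) :
    Integrable (fun x => q x * poissonWeight c r x) P := by
  refine hq.mul_bdd (c := 1) (measurable_poissonWeight c r).aestronglyMeasurable
    (Eventually.of_forall fun x => ?_)
  rw [Real.norm_of_nonneg (poissonWeight_nonneg _ _ _)]
  exact le_hasSum (hasSum_poissonWeight c x) r fun _ _ => poissonWeight_nonneg _ _ _

/-- The density `q` serves two cases: `q = 1` for the mixed Poisson law, and `q x = x c` for its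
size-biased version. Sum and integral are exchanged because the norms are dominated by `q` times
Poisson probabilities, of total mass one. -/
theorem hasSum_integral_mul_poissonWeight {P : Measure ℝ≥0} {q : ℝ≥0 → ℝ} (hq0 : ∀ x, 0 ≤ q x)
    (hq : Integrable q P) (c : ℝ≥0) {z : ℂ} (hz : ‖z‖ ≤ 1) :
    HasSum (fun r => ((∫ x, q x * poissonWeight c r x ∂P : ℝ) : ℂ) * z ^ r)
      (∫ x, (q x : ℂ) * Complex.exp (-((x * c : ℝ) * (1 - z))) ∂P) := by
  have hint := integrable_mul_poissonWeight hq c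
  have hnn : ∀ r x, 0 ≤ q x * poissonWeight c r x := fun r x =>
    mul_nonneg (hq0 x) (poissonWeight_nonneg _ _ _)
  have hF : ∀ r, Integrable (fun x => ((q x * poissonWeight c r x : ℝ) : ℂ) * z ^ r) P :=
    fun r => (hint r).ofReal.mul_const _
  have hnorm : ∀ r x, ‖((q x * poissonWeight c r x : ℝ) : ℂ) * z ^ r‖
      ≤ q x * poissonWeight c r x := fun r x => by
    rw [norm_mul, Complex.norm_real, Real.norm_of_nonneg (hnn r x), norm_pow]
    exact mul_le_of_le_one_right (hnn r x) (pow_le_one₀ (norm_nonneg z) hz)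
  have hsum : Summable fun r => ∫ x, ‖((q x * poissonWeight c r x : ℝ) : ℂ) * z ^ r‖ ∂P := by
    refine summable_of_sum_le (c := ∫ x, q x ∂P)
      (fun r => integral_nonneg fun x => norm_nonneg _) fun s => ?_
    rw [← integral_finsetSum _ fun r _ => (hF r).norm]
    refine integral_mono (integrable_finsetSum _ fun r _ => (hF r).norm) hq fun x => ?_
    refine (Finset.sum_le_sum fun r _ => hnorm r x).trans ?_
    rw [← Finset.mul_sum]
    exact mul_le_of_le_one_right (hq0 x) (sum_le_hasSum s
      (fun r _ => poissonWeight_nonneg _ _ _) (hasSum_poissonWeight c x))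
  have h := hasSum_integral_of_summable_integral_norm hF hsum
  convert! h using 1
  · funext r
    rw [integral_mul_const, integral_complex_ofReal]
  · refine integral_congr_ae (Eventually.of_forall fun x => ?_)
    have := (hasSum_poissonWeight_mul_pow c x z).mul_left (q x : ℂ)
    simp only
    rw [← this.tsum_eq]
    refine tsum_congr fun r => ?_
    push_cast
    ring

variable (P : Measure ℝ≥0) [IsProbabilityMeasure P]

theorem mixedPoisson_apply (c : ℝ≥0) (r : ℕ) :
    mixedPoisson P c r = ∫⁻ x, ENNReal.ofReal (poissonWeight c r x) ∂P := rfl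

theorem toReal_mixedPoisson_apply (c : ℝ≥0) (r : ℕ) :
    (mixedPoisson P c r).toReal = ∫ x, poissonWeight c r x ∂P := by
  rw [integral_eq_lintegral_of_nonneg_ae (Eventually.of_forall fun x => poissonWeight_nonneg _ _ _)
    (measurable_poissonWeight c r).aestronglyMeasurable, mixedPoisson_apply]

theorem pmfMean_mixedPoisson (c : ℝ≥0) :
    pmfMean (mixedPoisson P c) = (∫⁻ x, (x : ℝ≥0∞) ∂P) * c := by
  rw [← tsum_shift]
  have h : ∀ r : ℕ, ((r : ℝ≥0∞) + 1) * mixedPoisson P c (r + 1)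
      = ∫⁻ x : ℝ≥0, (x * c : ℝ≥0∞) * ENNReal.ofReal (poissonWeight c r x) ∂P := fun r => by
    rw [mixedPoisson_apply, ← lintegral_const_mul _ (measurable_poissonWeight c _).ennreal_ofReal]
    refine lintegral_congr fun x => ?_
    have h1 : ((r : ℝ≥0∞) + 1) = ENNReal.ofReal ((r : ℝ) + 1) := by
      rw [ENNReal.ofReal_add (by positivity) zero_le_one, ENNReal.ofReal_natCast,
        ENNReal.ofReal_one]
    have h2 : (x * c : ℝ≥0∞) = ENNReal.ofReal (x * c : ℝ) := by
      rw [ENNReal.ofReal_mul x.coe_nonneg, ENNReal.ofReal_coe_nnreal, ENNReal.ofReal_coe_nnreal]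
    rw [h1, h2, ← ENNReal.ofReal_mul (by positivity), ← ENNReal.ofReal_mul (by positivity),
      succ_mul_poissonWeight]
  have hmeas : ∀ r : ℕ, Measurable fun x : ℝ≥0 =>
      (x * c : ℝ≥0∞) * ENNReal.ofReal (poissonWeight c r x) := fun r =>
    Measurable.mul (by fun_prop) (measurable_poissonWeight c r).ennreal_ofReal
  simp only [h]
  rw [← lintegral_tsum fun r => (hmeas r).aemeasurable,
    ← lintegral_mul_const _ (by fun_prop)]
  refine lintegral_congr fun x => ?_
  rw [ENNReal.tsum_mul_left, ← ENNReal.ofReal_tsum_of_nonneg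
    (fun r => poissonWeight_nonneg c r x) (hasSum_poissonWeight c x).summable,
    (hasSum_poissonWeight c x).tsum_eq, ENNReal.ofReal_one, mul_one]

variable {P}

theorem integral_pmf_pow (Q : PMF ℕ) {z : ℂ} (hz : ‖z‖ ≤ 1) {s : ℂ}
    (h : HasSum (fun r => ((Q r).toReal : ℂ) * z ^ r) s) : ∫ r, z ^ r ∂Q.toMeasure = s := by
  rw [PMF.integral_eq_tsum, ← h.tsum_eq]
  · exact tsum_congr fun r => by rw [Complex.real_smul]
  · refine Integrable.of_bound (C := 1) (measurable_from_top).aestronglyMeasurable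
      (Eventually.of_forall fun r => ?_)
    rw [norm_pow]
    exact pow_le_one₀ (norm_nonneg z) hz

theorem integral_mixedPoisson_pow (c : ℝ≥0) {z : ℂ} (hz : ‖z‖ ≤ 1) :
    ∫ r, z ^ r ∂(mixedPoisson P c).toMeasure
      = ∫ x : ℝ≥0, Complex.exp (-((x * c : ℝ) * (1 - z))) ∂P := by
  refine integral_pmf_pow _ hz ?_
  have h := hasSum_integral_mul_poissonWeight (P := P) (q := fun _ => 1)
    (fun _ => zero_le_one) (integrable_const _) c hz
  simpa [toReal_mixedPoisson_apply] using h

theorem integral_sizeBiased_mixedPoisson_pow (hP : ∫⁻ x, (x : ℝ≥0∞) ∂P < ∞) (c : ℝ≥0)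
    (hmean : mean P * c ≠ 0) {z : ℂ} (hz : ‖z‖ ≤ 1) :
    ∫ r, z ^ r ∂(sizeBiased (mixedPoisson P c)).toMeasure
      = (mean P : ℂ)⁻¹ * ∫ x : ℝ≥0, (x : ℝ) * Complex.exp (-((x * c : ℝ) * (1 - z))) ∂P := by
  have hM : pmfMean (mixedPoisson P c) = (mean P * c : ℝ≥0) := by
    rw [pmfMean_mixedPoisson, ENNReal.coe_mul, mean, ENNReal.coe_toNNReal hP.ne]
  have hM0 : pmfMean (mixedPoisson P c) ≠ 0 ∧ pmfMean (mixedPoisson P c) ≠ ∞ := by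
    rw [hM]
    exact ⟨by exact_mod_cast hmean, ENNReal.coe_ne_top⟩
  refine integral_pmf_pow _ hz ?_
  have hval : ∀ r, (sizeBiased (mixedPoisson P c) r).toReal
      = (mean P * c : ℝ)⁻¹ * ∫ x : ℝ≥0, (x * c : ℝ) * poissonWeight c r x ∂P := fun r => by
    have h1 : sizeBiased (mixedPoisson P c) r
        = ((r : ℝ≥0∞) + 1) / pmfMean (mixedPoisson P c) * mixedPoisson P c (r + 1) := by
      have : sizeBiased (mixedPoisson P c) = _ := dif_pos hM0
      rw [this]
      rfl
    simp only [← succ_mul_poissonWeight]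
    rw [h1, hM, ENNReal.toReal_mul, ENNReal.toReal_div, toReal_mixedPoisson_apply,
      integral_const_mul, ENNReal.coe_toReal,
      ENNReal.toReal_add (ENNReal.natCast_ne_top r) ENNReal.one_ne_top]
    push_cast
    simp only [ENNReal.toReal_natCast, ENNReal.toReal_one]
    ring
  have hc : (c : ℂ) ≠ 0 := by
    have := right_ne_zero_of_mul hmean
    exact_mod_cast this
  have h := (hasSum_integral_mul_poissonWeight (P := P) (q := fun x => (x * c : ℝ))
    (fun x => by positivity) ((integrable_coe_nnreal hP).mul_const _) c hz).mul_left
      (((mean P * c : ℝ)⁻¹ : ℝ) : ℂ)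
  convert! h using 1
  · funext r
    rw [hval]
    push_cast
    ring
  · have : ∀ x : ℝ≥0, ((x * c : ℝ) : ℂ) * Complex.exp (-((x * c : ℝ) * (1 - z)))
        = c * ((x : ℝ) * Complex.exp (-((x * c : ℝ) * (1 - z)))) := fun x => by
      push_cast; ring
    simp only [this]
    rw [integral_const_mul]
    generalize ∫ x : ℝ≥0, ((x : ℝ) : ℂ) * Complex.exp (-((x * c : ℝ) * (1 - z))) ∂P = J
    push_cast
    field_simp

end Mixture

theorem integral_infinitePi_pow_sum (Q : Measure ℕ) [IsProbabilityMeasure Q] (z : ℂ) (N : ℕ) :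
    ∫ τ : ℕ → ℕ, z ^ ∑ j ∈ Finset.range N, τ j ∂Measure.infinitePi (fun _ => Q)
      = (∫ r, z ^ r ∂Q) ^ N := by
  have h := integral_fintype_prod_eq_pow (ι := Fin N) (fun r : ℕ => z ^ r) (μ := Q)
  rw [Fintype.card_fin, ← map_infinitePi_fin Q N, integral_map
    (measurable_pi_lambda _ fun j => measurable_pi_apply _).aemeasurable] at h
  · rw [← h]
    refine integral_congr_ae (Eventually.of_forall fun τ => ?_)
    simp only
    rw [Finset.prod_pow_eq_pow_sum, Finset.sum_range]
  · exact (Finset.measurable_prod _ fun j _ => (measurable_from_top : Measurable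
      fun r : ℕ => z ^ r).comp (measurable_pi_apply j)).aestronglyMeasurable

theorem measurable_dStar : Measurable dStar := by
  refine measurable_from_prod_countable_right fun N => ?_
  exact Finset.measurable_sum (Finset.range N) fun j _ => measurable_pi_apply (X := fun _ : ℕ => ℕ) j

variable {P₁ P₂ : Measure ℝ≥0} [IsProbabilityMeasure P₁] [IsProbabilityMeasure P₂]

/-- Given `Λ₁ = N`, the generating function is `g ^ N` with `g` that of `τ_1`; averaging over `N`
evaluates the mixed Poisson generating function at `g`. -/
theorem integral_limitLaw_pow_dStar_eq (β : ℝ≥0) {z : ℂ} (hz : ‖z‖ ≤ 1) :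
    ∫ ω, z ^ dStar ω ∂limitLaw P₁ P₂ β
      = ∫ y : ℝ≥0, Complex.exp (-((y * (mean P₁ * NNReal.sqrt β : ℝ≥0) : ℝ) *
          (1 - ∫ r, z ^ r ∂(sizeBiased (lawΛ₂ P₁ P₂ β)).toMeasure))) ∂P₂ := by
  have hpow : ∀ d : ℕ, ‖z ^ d‖ ≤ 1 := fun d => by
    rw [norm_pow]; exact pow_le_one₀ (norm_nonneg z) hz
  have hint : Integrable (fun ω => z ^ dStar ω) (limitLaw P₁ P₂ β) :=
    Integrable.of_bound (C := 1) ((measurable_from_top : Measurable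
      fun r : ℕ => z ^ r).comp measurable_dStar).aestronglyMeasurable
      (Eventually.of_forall fun ω => hpow _)
  rw [limitLaw] at hint ⊢
  rw [integral_prod _ hint]
  simp only [dStar, integral_infinitePi_pow_sum]
  rw [lawΛ₁, integral_mixedPoisson_pow]
  -- The mixed Poisson formula is applied at `g`, which must lie in the unit disc.
  simpa using norm_integral_le_of_norm_le_const
    (μ := (sizeBiased (lawΛ₂ P₁ P₂ β)).toMeasure) (Eventually.of_forall hpow)

theorem integral_limitLaw_pow_dStar (hX : ∫⁻ x, (x : ℝ≥0∞) ∂P₁ < ∞) (β : ℝ≥0)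
    {z : ℂ} (hz : ‖z‖ ≤ 1) :
    ∫ ω, z ^ dStar ω ∂limitLaw P₁ P₂ β
      = ∫ y : ℝ≥0, Complex.exp (-((Real.sqrt β * y : ℝ) *
        limitRate P₁ (mean P₂ / Real.sqrt β) z)) ∂P₂ := by
  rw [integral_limitLaw_pow_dStar_eq β hz]
  refine integral_congr_ae (Eventually.of_forall fun y => ?_)
  simp only
  congr 2
  have hc : ((mean P₂ * (NNReal.sqrt β)⁻¹ : ℝ≥0) : ℝ) = mean P₂ / Real.sqrt β := by
    push_cast
    rw [div_eq_mul_inv]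
  have hexp : ∀ x : ℝ≥0,
      ‖Complex.exp (-((x * (mean P₂ / Real.sqrt β) : ℝ) * (1 - z)))‖ ≤ 1 := fun x => by
    rw [Complex.norm_exp, Real.exp_le_one_iff, Complex.neg_re, Complex.re_ofReal_mul,
      neg_nonpos]
    refine mul_nonneg (by positivity) ?_
    have := (Complex.re_le_norm z).trans hz
    simpa using this
  have hXi : Integrable (fun x : ℝ≥0 => ((x : ℝ) : ℂ)) P₁ := (integrable_coe_nnreal hX).ofReal
  have hXe : Integrable (fun x : ℝ≥0 =>
      ((x : ℝ) : ℂ) * Complex.exp (-((x * (mean P₂ / Real.sqrt β) : ℝ) * (1 - z)))) P₁ :=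
    hXi.mul_bdd (c := 1) (by fun_prop) (Eventually.of_forall hexp)
  have hrate : limitRate P₁ (mean P₂ / Real.sqrt β) z = mean P₁ -
      ∫ x : ℝ≥0, (x : ℝ) * Complex.exp (-((x * (mean P₂ / Real.sqrt β) : ℝ) * (1 - z))) ∂P₁ := by
    simp only [limitRate, mul_sub, mul_one]
    simp only [mul_sub, mul_one] at hXe
    rw [integral_sub hXi hXe, integral_complex_ofReal, integral_coe_nnreal_eq_mean]
  -- If `E Λ₂ = 0`, the default unit mass at `0` has generating function `1`. The rate vanishes too:
  -- either `x = 0` almost everywhere, or the exponent in `limitRate` is zero.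
  by_cases hmean : mean P₁ * (mean P₂ * (NNReal.sqrt β)⁻¹) = 0
  · have hM : pmfMean (lawΛ₂ P₁ P₂ β) = 0 := by
      rw [lawΛ₂, pmfMean_mixedPoisson, ← ENNReal.coe_toNNReal hX.ne, ← ENNReal.coe_mul]
      exact_mod_cast hmean
    have hsb : sizeBiased (lawΛ₂ P₁ P₂ β) = PMF.pure 0 := dif_neg fun h => h.1 hM
    have h1 : ∫ r, z ^ r ∂(sizeBiased (lawΛ₂ P₁ P₂ β)).toMeasure = 1 := by
      rw [hsb, PMF.toMeasure_pure, integral_dirac, pow_zero]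
    have h2 : limitRate P₁ (mean P₂ / Real.sqrt β) z = 0 := by
      rcases mul_eq_zero.1 hmean with h | h
      · have h3 : ∫ x : ℝ≥0, (x : ℝ) ∂P₁ = 0 := by
          rw [integral_coe_nnreal_eq_mean, h, NNReal.coe_zero]
        have h4 := (integral_eq_zero_iff_of_nonneg (fun x : ℝ≥0 => x.coe_nonneg)
          (integrable_coe_nnreal hX)).1 h3
        refine integral_eq_zero_of_ae ?_
        filter_upwards [h4] with x hx
        simp only [Pi.zero_apply] at hx
        simp [hx]
      · rw [← hc, h]
        simp [limitRate]
    rw [h1, h2]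
    simp
  · have h1 := integral_sizeBiased_mixedPoisson_pow hX _ hmean hz
    have ha : (mean P₁ : ℂ) ≠ 0 := by
      have := left_ne_zero_of_mul hmean
      exact_mod_cast this
    rw [lawΛ₂, h1, hc, hrate]
    generalize ∫ x : ℝ≥0, ((x : ℝ) : ℂ) *
      Complex.exp (-((x * (mean P₂ / Real.sqrt β) : ℝ) * (1 - z))) ∂P₁ = J
    push_cast
    field_simp

end RIG

theorem theorem1 (P₁ P₂ : Measure ℝ≥0) [IsProbabilityMeasure P₁] [IsProbabilityMeasure P₂]
    (hX : ∫⁻ x, (x : ℝ≥0∞) ∂P₁ < ∞) (hY : ∫⁻ y, (y : ℝ≥0∞) ∂P₂ < ∞)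
    (β : ℝ≥0) (hβ : 0 < β) (n m : ℕ → ℕ) (hpos : ∀ k, 0 < n k)
    (hn : Tendsto n atTop atTop) (hm : Tendsto m atTop atTop)
    (hnm : Tendsto (fun k => (m k : ℝ) / (n k : ℝ)) atTop (𝓝 (β : ℝ))) :
    TendstoInDistribution
      (fun k (ω : ((Fin (m k) → ℝ≥0) × (Fin (n k) → ℝ≥0)) × (Fin (m k) → Fin (n k) → Bool)) =>
        (RIG.intersectionGraph ω.2).degree ⟨0, hpos k⟩)
      atTop RIG.dStar (fun k => RIG.modelLaw P₁ P₂ (n k) (m k)) (RIG.limitLaw P₁ P₂ β) := by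
  refine tendstoInDistribution_nat_of_tendsto_integral_pow (fun k => ?_) RIG.measurable_dStar
    fun z hz => ?_
  · exact (measurable_of_finite fun h : Fin (m k) → Fin (n k) → Bool =>
      (RIG.intersectionGraph h).degree ⟨0, hpos k⟩).comp measurable_snd
  · rw [RIG.integral_limitLaw_pow_dStar hX β hz.le]
    exact RIG.tendsto_integral_modelLaw_pow_degree hX hY (by exact_mod_cast hβ) hpos hn hm hnm
      hz.le
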